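/- \textbf{Conventions.} $\mathcal H$ is a complex Hilbert space of arbitrary dimension, $\mathcal B(\mathcal H)_{\ge 0}$ is the set of bounded positive semi-definite (PSD) operators on it, $\le$ is the PSD order, $\mathcal S(\mathcal H)$ is the set of density operators (PSD operators of trace $1$), $\mathcal B(\mathcal H)_{[0,1]}=\{T:0\le T\le I\}$, and $\mathbb N=\{1,2,\dots\}$. For PSD operators $B,X$ the trace $\mathrm{Tr}\,X^{1/2}BX^{1/2}\in[0,+\infty]$ is always defined, and it equals $\mathrm{Tr}\,BX$ whenever $BX$ is trace-class. For a topological space $\mathcal Y$, $\mathcal S(\mathcal Y)$ is the set of Borel probability measures on $\mathcal Y$. We use $\log 0=-\infty$ and $\exp(-\infty)=0$. \textbf{Theorem.} Let $\mathcal Y$ be a non-empty compact Hausdorff space, let $\mathcal Y\ni y\mapsto A_y\in\mathcal B(\mathcal H)_{\ge0}$ be continuous in operator norm, and let $C\in\mathcal B(\mathcal H)_{\ge 0}$. For every $n\in\mathbb N$ let $\mathcal X_n\subseteq\mathcal B(\mathcal H^{\otimes n})_{\ge0}$ be such that (a) $A_y^{\otimes n}X$ and $C^{\otimes n}X$ are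 trace-class for all $y\in\mathcal Y$, $X\in\mathcal X_n$; (b) $X_1\otimes X_2\in\mathcal X_{n+m}$ for all $X_1\in\mathcal X_n$, $X_2\in\mathcal X_m$, $n,m\in\mathbb N$; (c) $y\mapsto\mathrm{Tr}\,A_y^{\otimes n}X$ is continuous for every $X\in\mathcal X_n$; (d) for all $S,T\in\mathcal B(\mathcal H^{\otimes n})_{\ge0}$ such that $SX$ and $TX$ are trace-class for every $X\in\mathcal X_n$, we have $S\le T$ if and only if $\mathrm{Tr}\,SX\le\mathrm{Tr}\,TX$ for all $X\in\mathcal X_n$. Assume moreover that for every $n\in\mathbb N$ there are a convex set $\tilde{\mathcal S}_n\subseteq\mathcal S(\mathcal H^{\otimes n})$ and a $\delta_n>0$ such that $\inf_{\varrho\in\tilde{\mathcal S}_n}\mathrm{Tr}\,\varrho Z=\inf\mathrm{spec}(Z)$ for all $Z\in\mathcal B(\mathcal H^{\otimes n})_{\ge0}$, and $$\tilde{\mathcal X}_n:=\{(C^{\otimes n}+\varepsilon I)^{-1/2}\varrho\,(C^{\otimes n}+\varepsilon I)^{-1/2}:\ \varrho\in\tilde{\mathcal S}_n,\ \varepsilon\in(0,\delta_n)\}\subseteq\mathcal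 X_n .$$ Then the following are equivalent: 1. For every $n\in\mathbb N$ and $X\in\mathcal B(\mathcal H^{\otimes n})_{\ge0}$, $\mathrm{Tr}\,X^{1/2}C^{\otimes n}X^{1/2}\le\sup_{y}\mathrm{Tr}\,X^{1/2}A_y^{\otimes n}X^{1/2}$. 2. For every $n\in\mathbb N$ and $X\in\mathcal X_n$, $\mathrm{Tr}\,C^{\otimes n}X\le\sup_y\mathrm{Tr}\,A_y^{\otimes n}X$. 3. For every $n\in\mathbb N$ and $X\in\tilde{\mathcal X}_n$, $\mathrm{Tr}\,C^{\otimes n}X\le\sup_y\mathrm{Tr}\,A_y^{\otimes n}X$. 4. For every $n\in\mathbb N$ there is a $\mu_n\in\mathcal S(\mathcal Y)$ with $C^{\otimes n}\le\int_{\mathcal Y}A_y^{\otimes n}\,d\mu_n(y)$. 5. There is a $\mu\in\mathcal S(\mathcal Y)$ with $C^{\otimes n}\le\int_{\mathcal Y}A_y^{\otimes n}\,d\mu(y)$ for all $n\in\mathbb N$. 6. There is a $\nu\in\mathcal S(\mathcal Y)$ with $\mathrm{Tr}\,C^{\otimes n}X\le\exp\left(\int_{\mathcal Y}\log\mathrm{Tr}\,A_y^{\otimes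 n}X\,d\nu(y)\right)$ for all $n\in\mathbb N$ and $X\in\mathcal X_n$. \textbf{Corollary.} Let $\mathcal R\subseteq\mathcal S(\mathcal H)$ be non-empty and compact in the operator norm (on $\mathcal S(\mathcal H)$ the operator norm and the trace norm induce the same topology), and let $C\in\mathcal B(\mathcal H)_{\ge0}$. In this part, $\mathrm{Tr}\,BX$ for PSD $B,X$ stands for $\mathrm{Tr}\,X^{1/2}BX^{1/2}\in[0,+\infty]$. Then the following are equivalent: 1. $C\in\mathcal C(\mathcal R)$, i.e., there are $\kappa_n\in(0,+\infty)$, $n\in\mathbb N$, with $\limsup_{n\to\infty}\frac1n\log\kappa_n\le0$ and $\mathrm{Tr}\,C^{\otimes n}T\le\kappa_n\sup_{\omega\in\mathcal R}\mathrm{Tr}\,\omega^{\otimes n}T$ for all $T\in\mathcal B(\mathcal H^{\otimes n})_{[0,1]}$ and $n\in\mathbb N$. 2. $\mathrm{Tr}\,C^{\otimes n}T\le\sup_{\omega\in\mathcal R}\mathrm{Tr}\,\omega^{\otimes n}T$ for all $T\in\mathcal B(\mathcal H^{\otimes n})_{[0,1]}$ and $n\in\mathbb N$. 3. There is a $\mu\in\mathcal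 S(\mathcal R)$ with $C^{\otimes n}\le\int_{\mathcal R}\omega^{\otimes n}\,d\mu(\omega)$ for all $n\in\mathbb N$. 4. There is a $\nu\in\mathcal S(\mathcal R)$ with $\mathrm{Tr}\,C^{\otimes n}X\le\exp\left(\int_{\mathcal R}\log\mathrm{Tr}\,\omega^{\otimes n}X\,d\nu(\omega)\right)$ for all $X\in\mathcal B(\mathcal H^{\otimes n})_{\ge0}$ and $n\in\mathbb N$. -/

import Mathlib

open scoped TensorProduct ENNReal InnerProductSpace
open UniformSpace MeasureTheory Filter

universe u v

noncomputable section

namespace WeakMean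

/-! ### Trace of operators on a (possibly infinite-dimensional) complex Hilbert space -/

section Trace

variable (K : Type u) [NormedAddCommGroup K] [InnerProductSpace ℂ K] [CompleteSpace K]

/-- The index set of a fixed Hilbert basis (complete orthonormal system) of `K`. -/
def basisIndex : Set K := (exists_hilbertBasis ℂ K).choose

/-- A fixed Hilbert basis of `K`, used to compute traces. -/
def stdBasis : HilbertBasis (basisIndex K) ℂ K := (exists_hilbertBasis ℂ K).choose_spec.choose

variable {K}

/-- The trace `∑ ⟨eᵢ, A eᵢ⟩ ∈ [0, ∞]` of a positive semi-definite operator `A`. -/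
def psdTrace (A : K →L[ℂ] K) : ℝ≥0∞ :=
  ∑' i, ENNReal.ofReal (⟪stdBasis K i, A (stdBasis K i)⟫_ℂ).re

/-- `T` is trace-class: `Tr |T| < ∞`, where `|T| = (T* T)^{1/2}`. -/
def IsTraceClass (T : K →L[ℂ] K) : Prop := psdTrace (CFC.abs T) < ∞

/-- The trace `∑ ⟨eᵢ, T eᵢ⟩` of a trace-class operator `T`. -/
def tr (T : K →L[ℂ] K) : ℂ := ∑' i, ⟪stdBasis K i, T (stdBasis K i)⟫_ℂ

/-- `Tr X^{1/2} A X^{1/2} ∈ [0, ∞]` for positive semi-definite operators `A`, `X`. -/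
def sandwichTrace (A X : K →L[ℂ] K) : ℝ≥0∞ := psdTrace (CFC.sqrt X * A * CFC.sqrt X)

variable (K) in
/-- The set `𝒮(K)` of density operators: positive semi-definite operators of trace one. -/
def densityOperators : Set (K →L[ℂ] K) := {ρ | 0 ≤ ρ ∧ psdTrace ρ = 1}

end Trace

/-! ### Hilbert space tensor products and tensor powers -/

section Tensor

/-- The Hilbert space tensor product: completion of the algebraic tensor product. -/
abbrev HTensor (E F : Type*) [NormedAddCommGroup E] [InnerProductSpace ℂ E]
    [NormedAddCommGroup F] [InnerProductSpace ℂ F] : Type _ :=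
  Completion (E ⊗[ℂ] F)

/-- The tensor product `S ⊗ T` of two bounded operators, on the Hilbert space tensor product. -/
def opTensor {E F : Type*} [NormedAddCommGroup E] [InnerProductSpace ℂ E]
    [NormedAddCommGroup F] [InnerProductSpace ℂ F] (S : E →L[ℂ] E) (T : F →L[ℂ] F) :
    HTensor E F →L[ℂ] HTensor E F :=
  (TensorProduct.mapL S T).completion

/-- A complex inner product space, bundled, as needed to define tensor powers by recursion. -/
structure InnerSpace : Type (u + 1) where
  carrier : Type u
  [normed : NormedAddCommGroup carrier]
  [inner : InnerProductSpace ℂ carrier]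

attribute [instance] InnerSpace.normed InnerSpace.inner

variable (H : Type u) [NormedAddCommGroup H] [InnerProductSpace ℂ H]

/-- Recursion behind `AlgPow`; the zeroth power is the one-dimensional Hilbert space. -/
def algPowAux : ℕ → InnerSpace.{u}
  | 0 => ⟨EuclideanSpace ℂ PUnit.{u + 1}⟩
  | n + 1 => ⟨(algPowAux n).carrier ⊗[ℂ] H⟩

/-- The `n`-fold algebraic tensor power of `H`, with
`⟨x₁ ⊗ ⋯ ⊗ xₙ, y₁ ⊗ ⋯ ⊗ yₙ⟩ = ∏ ⟨xᵢ, yᵢ⟩`. -/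
def AlgPow (n : ℕ) : Type u := (algPowAux H n).carrier

instance (n : ℕ) : NormedAddCommGroup (AlgPow H n) := (algPowAux H n).normed
instance (n : ℕ) : InnerProductSpace ℂ (AlgPow H n) := (algPowAux H n).inner

/-- The identification `H^{⊗ (n+1)} = H^{⊗ n} ⊗ H` (algebraic tensor powers). -/
def algSucc (n : ℕ) : AlgPow H (n + 1) ≃ₗᵢ[ℂ] AlgPow H n ⊗[ℂ] H :=
  LinearIsometryEquiv.refl ℂ (AlgPow H n ⊗[ℂ] H)

/-- The zeroth tensor power is `ℂ`. -/
def algZero : AlgPow H 0 ≃ₗᵢ[ℂ] ℂ :=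
  (OrthonormalBasis.singleton PUnit.{u + 1} ℂ).repr.symm

/-- The `n`-th tensor power `H^{⊗ n}` of the Hilbert space `H`. -/
abbrev HilbertPow (n : ℕ) : Type u := Completion (AlgPow H n)

variable {H}

/-- `A ⊗ ⋯ ⊗ A` on the algebraic tensor power. -/
def algOpPow (A : H →L[ℂ] H) : (n : ℕ) → (AlgPow H n →L[ℂ] AlgPow H n)
  | 0 => ContinuousLinearMap.id ℂ _
  | n + 1 => ((algSucc H n).symm : AlgPow H n ⊗[ℂ] H →L[ℂ] AlgPow H (n + 1)) ∘L
      TensorProduct.mapL (algOpPow A n) A ∘L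
      ((algSucc H n) : AlgPow H (n + 1) →L[ℂ] AlgPow H n ⊗[ℂ] H)

/-- The tensor power `A^{⊗ n}`, a bounded operator on `H^{⊗ n}`. -/
def opPow (A : H →L[ℂ] H) (n : ℕ) : HilbertPow H n →L[ℂ] HilbertPow H n := (algOpPow A n).completion

variable (H)

/-- The juxtaposition isomorphism `H^{⊗ n} ⊗ H^{⊗ m} ≅ H^{⊗ (n+m)}` (algebraic tensor powers). -/
def algAppend (n : ℕ) : (m : ℕ) → (AlgPow H n ⊗[ℂ] AlgPow H m ≃ₗᵢ[ℂ] AlgPow H (n + m))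
  | 0 => (TensorProduct.congrIsometry (.refl ℂ (AlgPow H n)) (algZero H)).trans
      (TensorProduct.ridIsometry ℂ (AlgPow H n))
  | m + 1 => ((TensorProduct.congrIsometry (.refl ℂ (AlgPow H n)) (algSucc H m)).trans
      (TensorProduct.assocIsometry ℂ (AlgPow H n) (AlgPow H m) H).symm).trans
      ((TensorProduct.congrIsometry (algAppend n m) (.refl ℂ H)).trans (algSucc H (n + m)).symm)

/-- The canonical isometric map from the algebraic tensor product of two inner product spaces to
the Hilbert space tensor product of their completions. -/
def toHTensor (E F : Type*) [NormedAddCommGroup E] [InnerProductSpace ℂ E]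
    [NormedAddCommGroup F] [InnerProductSpace ℂ F] :
    E ⊗[ℂ] F →ₗᵢ[ℂ] HTensor (Completion E) (Completion F) :=
  Completion.toComplₗᵢ.comp
    (TensorProduct.mapIsometry Completion.toComplₗᵢ Completion.toComplₗᵢ)

theorem denseRange_toHTensor (E F : Type*) [NormedAddCommGroup E] [InnerProductSpace ℂ E]
    [NormedAddCommGroup F] [InnerProductSpace ℂ F] : DenseRange (toHTensor E F) := by
  have h : DenseRange (TensorProduct.mapIsometry (𝕜 := ℂ)
      (Completion.toComplₗᵢ (𝕜 := ℂ) (E := E)) (Completion.toComplₗᵢ (𝕜 := ℂ) (E := F))) := by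
    set f := TensorProduct.mapIsometry (𝕜 := ℂ)
      (Completion.toComplₗᵢ (𝕜 := ℂ) (E := E)) (Completion.toComplₗᵢ (𝕜 := ℂ) (E := F)) with hf
    have key : ∀ z, z ∈ (LinearMap.range f.toLinearMap).topologicalClosure := by
      intro z
      induction z using TensorProduct.induction_on with
      | zero => exact Submodule.zero_mem _
      | add x y hx hy => exact Submodule.add_mem _ hx hy
      | tmul x y =>
        refine Completion.induction_on₂ x y ?_ ?_
        · exact (Submodule.isClosed_topologicalClosure _).preimage
            (TensorProduct.continuous_tmul (𝕜 := ℂ))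
        · intro a b
          exact Submodule.le_topologicalClosure _ ⟨a ⊗ₜ b, by simp [hf]⟩
    intro z
    exact key z
  exact Completion.denseRange_coe.comp h (Completion.continuous_coe _)

/-- The juxtaposition isomorphism `H^{⊗ n} ⊗ H^{⊗ m} ≅ H^{⊗ (n+m)}` of Hilbert spaces. -/
def append (n m : ℕ) : HTensor (HilbertPow H n) (HilbertPow H m) ≃ₗᵢ[ℂ] HilbertPow H (n + m) :=
  (algAppend H n m).toLinearEquiv.extendOfIsometry
    (toHTensor (AlgPow H n) (AlgPow H m)).toLinearMap
    (Completion.toComplₗᵢ (𝕜 := ℂ) (E := AlgPow H (n + m))).toLinearMap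
    (denseRange_toHTensor _ _) Completion.denseRange_coe (by intro x; simp)

variable {H}

/-- For `S` on `H^{⊗ n}` and `T` on `H^{⊗ m}`, the operator `S ⊗ T` on `H^{⊗ (n+m)}`. -/
def powTensor {n m : ℕ} (S : HilbertPow H n →L[ℂ] HilbertPow H n) (T : HilbertPow H m →L[ℂ] HilbertPow H m) :
    HilbertPow H (n + m) →L[ℂ] HilbertPow H (n + m) :=
  ((append H n m) : HTensor (HilbertPow H n) (HilbertPow H m) →L[ℂ] HilbertPow H (n + m)) ∘L
    opTensor S T ∘L
    ((append H n m).symm : HilbertPow H (n + m) →L[ℂ] HTensor (HilbertPow H n) (HilbertPow H m))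

end Tensor

/-! ### Geometric means of functions, with `log 0 = -∞` and `exp (-∞) = 0` -/

section GeomMean

variable {Y : Type v} [MeasurableSpace Y]

/-- The integral `∫ g⁺ dν - ∫ g⁻ dν` of an extended real valued function. -/
def extIntegral (ν : Measure Y) (g : Y → EReal) : EReal :=
  ((∫⁻ y, (g y).toENNReal ∂ν : ℝ≥0∞) : EReal) - ((∫⁻ y, (-g y).toENNReal ∂ν : ℝ≥0∞) : EReal)

/-- The weighted geometric mean `exp (∫ log f dν)` of a function `f : Y → [0, ∞]`. -/
def geomMean (ν : Measure Y) (f : Y → ℝ≥0∞) : ℝ≥0∞ :=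
  EReal.exp (extIntegral ν fun y => ENNReal.log (f y))

end GeomMean

/-! ### The setting of the weak bounds -/

section Setting

variable {H : Type u} [NormedAddCommGroup H] [InnerProductSpace ℂ H]

/-- The standing assumptions on the sets `𝒳 n` of positive semi-definite operators on `H^{⊗ n}`,
`n ≥ 1`. -/
structure TraceAssumption {Y : Type v} [TopologicalSpace Y] (A : Y → (H →L[ℂ] H))
    (C : H →L[ℂ] H) (𝒳 : (n : ℕ) → Set (HilbertPow H n →L[ℂ] HilbertPow H n)) : Prop where
  nonneg : ∀ n, 1 ≤ n → ∀ X ∈ 𝒳 n, 0 ≤ X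
  traceClass_family : ∀ n, 1 ≤ n → ∀ X ∈ 𝒳 n, ∀ y, IsTraceClass (opPow (A y) n * X)
  traceClass_bound : ∀ n, 1 ≤ n → ∀ X ∈ 𝒳 n, IsTraceClass (opPow C n * X)
  tensor_mem : ∀ n m, 1 ≤ n → 1 ≤ m → ∀ X₁ ∈ 𝒳 n, ∀ X₂ ∈ 𝒳 m, powTensor X₁ X₂ ∈ 𝒳 (n + m)
  continuous_trace : ∀ n, 1 ≤ n → ∀ X ∈ 𝒳 n, Continuous fun y => tr (opPow (A y) n * X)

/-- The set `𝒳` of positive semi-definite operators characterizes the positive semi-definite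
order: `S ≤ T` iff `Tr S X ≤ Tr T X` for all `X ∈ 𝒳`, whenever `S, T ≥ 0` are such that all these
traces are defined. -/
def CharacterizesOrder {K : Type u} [NormedAddCommGroup K] [InnerProductSpace ℂ K]
    [CompleteSpace K] (𝒳 : Set (K →L[ℂ] K)) : Prop :=
  ∀ S T : K →L[ℂ] K, 0 ≤ S → 0 ≤ T →
    (∀ X ∈ 𝒳, IsTraceClass (S * X) ∧ IsTraceClass (T * X)) →
    (S ≤ T ↔ ∀ X ∈ 𝒳, (tr (S * X)).re ≤ (tr (T * X)).re)

/-- `inf_{ρ ∈ 𝒮} Tr ρ Z = inf spec Z` for all positive semi-definite `Z`. -/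
def AttainsInfSpec {K : Type u} [NormedAddCommGroup K] [InnerProductSpace ℂ K]
    [CompleteSpace K] (𝒮 : Set (K →L[ℂ] K)) : Prop :=
  ∀ Z : K →L[ℂ] K, 0 ≤ Z → sInf ((fun ρ => (tr (ρ * Z)).re) '' 𝒮) = sInf (spectrum ℝ Z)

/-- The set `{(D + ε I)^{-1/2} ρ (D + ε I)^{-1/2} : ρ ∈ 𝒮, ε ∈ (0, δ)}`. -/
def rescaled {K : Type u} [NormedAddCommGroup K] [InnerProductSpace ℂ K] [CompleteSpace K]
    (D : K →L[ℂ] K) (𝒮 : Set (K →L[ℂ] K)) (δ : ℝ) : Set (K →L[ℂ] K) :=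
  {X | ∃ ρ ∈ 𝒮, ∃ ε ∈ Set.Ioo 0 δ,
    X = (D + ε • (1 : K →L[ℂ] K)) ^ (-(1 / 2) : ℝ) * ρ *
      (D + ε • (1 : K →L[ℂ] K)) ^ (-(1 / 2) : ℝ)}

/-- The set `𝒞(ℛ)` of operators `C ≥ 0` for which there are `κₙ ∈ (0, ∞)` with
`Tr C^{⊗ n} T ≤ κₙ sup_{ω ∈ ℛ} Tr ω^{⊗ n} T` for all tests `0 ≤ T ≤ I` on `H^{⊗ n}`, `n ≥ 1`, and
`limsup (1/n) log κₙ ≤ 0`. Traces of products of positive semi-definite operators are taken in the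
form `Tr T^{1/2} A T^{1/2} ∈ [0, ∞]`, which equals `Tr A T` if `A T` is trace-class. -/
def dominatedOperators [CompleteSpace H] (R : Set (H →L[ℂ] H)) : Set (H →L[ℂ] H) :=
  {C | 0 ≤ C ∧ ∃ κ : ℕ → ℝ, (∀ n, 1 ≤ n → 0 < κ n) ∧
    (∀ n, 1 ≤ n → ∀ T : HilbertPow H n →L[ℂ] HilbertPow H n, 0 ≤ T → T ≤ 1 →
      sandwichTrace (opPow C n) T ≤
        ENNReal.ofReal (κ n) * ⨆ ω ∈ R, sandwichTrace (opPow ω n) T) ∧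
    limsup (fun n : ℕ => ((1 / (n : ℝ) * Real.log (κ n) : ℝ) : EReal)) atTop ≤ 0}

end Setting

end WeakMean

end

open WeakMean

/-!
A measure on `Y` is produced by Hahn-Banach separation and the Riesz-Markov-Kakutani theorem: if no
function in a convex set of continuous functions is negative everywhere, then some probability
measure integrates all of them to nonnegative numbers. For fixed `n`, this applies to the functions
`y ↦ Tr A_y^{⊗n} X - Tr C^{⊗n} X` with `X` in the convex set
`(C^{⊗n} + ε)^{-1/2} 𝒮 (C^{⊗n} + ε)^{-1/2}`, which is large enough to detect the operator order.

The trace is multiplicative on tensor products, so for all `n` at once the relevant functions are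
`log Tr A_y^{⊗n} X - log Tr C^{⊗n} X`, which form a set closed under addition. Passing to large
multiples, the convex hull of such a set contains no everywhere negative function either, and the
resulting measure `ν` gives the bound by the geometric mean. Jensen's inequality turns that bound
into `C^{⊗n} ≤ ∫ A_y^{⊗n} dν` with the same `ν`.

The constants `κ_n` in the definition of `𝒞(ℛ)` disappear on replacing a test `T` by `T^{⊗k}`,
taking `k`-th roots and letting `k → ∞`.
-/

namespace WeakMean

open ContinuousLinearMap Topology

section HilbertSchmidt

theorem summable_norm_mul_norm {ι E F : Type*} [SeminormedAddCommGroup E]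
    [SeminormedAddCommGroup F] {f : ι → E} {g : ι → F} (hf : ∑' i, ‖f i‖ₑ ^ 2 ≠ ∞)
    (hg : ∑' i, ‖g i‖ₑ ^ 2 ≠ ∞) : Summable fun i => ‖f i‖ * ‖g i‖ := by
  have hf' : Summable fun i => ‖f i‖ ^ 2 := by simpa using ENNReal.summable_toReal hf
  have hg' : Summable fun i => ‖g i‖ ^ 2 := by simpa using ENNReal.summable_toReal hg
  refine .of_nonneg_of_le (fun i => by positivity) (fun i => ?_) (hf'.add hg')
  nlinarith [two_mul_le_add_sq ‖f i‖ ‖g i‖, norm_nonneg (f i), norm_nonneg (g i)]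

variable {K L M ι κ : Type*} [NormedAddCommGroup K] [InnerProductSpace ℂ K]
  [NormedAddCommGroup L] [InnerProductSpace ℂ L] [NormedAddCommGroup M] [InnerProductSpace ℂ M]

theorem tsum_enorm_inner_sq (b : HilbertBasis ι ℂ K) (x : K) :
    ∑' i, ‖⟪b i, x⟫_ℂ‖ₑ ^ 2 = ‖x‖ₑ ^ 2 := by
  have hsum : HasSum (fun i => ‖⟪b i, x⟫_ℂ‖ ^ 2) (‖x‖ ^ 2) := by
    convert Complex.hasSum_re (b.hasSum_inner_mul_inner x x) using 1
    · ext i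
      rw [← inner_conj_symm x (b i), mul_comm, Complex.mul_conj, Complex.ofReal_re,
        Complex.normSq_eq_norm_sq]
    · exact (inner_self_eq_norm_sq (𝕜 := ℂ) x).symm
  have h := ENNReal.ofReal_tsum_of_nonneg (fun i => sq_nonneg ‖⟪b i, x⟫_ℂ‖) hsum.summable
  simpa only [hsum.tsum_eq, ENNReal.ofReal_pow (norm_nonneg _), ofReal_norm] using h.symm

theorem tsum_prod_enorm_inner_sq (b : HilbertBasis ι ℂ K) (f : κ → K) :
    ∑' p : κ × ι, ‖⟪b p.2, f p.1⟫_ℂ‖ₑ ^ 2 = ∑' j, ‖f j‖ₑ ^ 2 := by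
  rw [ENNReal.tsum_prod (f := fun j i => ‖⟪b i, f j⟫_ℂ‖ₑ ^ 2)]
  simp only [tsum_enorm_inner_sq]

variable [CompleteSpace K]

/-- The square `∑ ‖P eᵢ‖² ∈ [0, ∞]` of the Hilbert-Schmidt norm of a bounded operator, computed in
the basis `stdBasis`; by `hsNormSq_eq_tsum` any other Hilbert basis gives the same value. -/
noncomputable def hsNormSq (P : K →L[ℂ] M) : ℝ≥0∞ := ∑' i, ‖P (stdBasis K i)‖ₑ ^ 2

theorem hsNormSq_comp_le (P : L →L[ℂ] M) (Q : K →L[ℂ] L) :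
    hsNormSq (P ∘L Q) ≤ ‖P‖ₑ ^ 2 * hsNormSq Q := by
  rw [hsNormSq, hsNormSq, ← ENNReal.tsum_mul_left]
  refine ENNReal.tsum_le_tsum fun i => ?_
  rw [← mul_pow]
  gcongr
  exact P.le_opENorm _

variable [CompleteSpace L]

theorem tsum_enorm_sq_adjoint (b : HilbertBasis ι ℂ K) (c : HilbertBasis κ ℂ L) (P : K →L[ℂ] L) :
    ∑' j, ‖adjoint P (c j)‖ₑ ^ 2 = ∑' i, ‖P (b i)‖ₑ ^ 2 := by
  calc ∑' j, ‖adjoint P (c j)‖ₑ ^ 2 = ∑' j, ∑' i, ‖⟪b i, adjoint P (c j)⟫_ℂ‖ₑ ^ 2 := by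
        simp only [tsum_enorm_inner_sq]
    _ = ∑' i, ∑' j, ‖⟪b i, adjoint P (c j)⟫_ℂ‖ₑ ^ 2 := ENNReal.tsum_comm
    _ = ∑' i, ∑' j, ‖⟪c j, P (b i)⟫_ℂ‖ₑ ^ 2 := by
        refine tsum_congr fun i => tsum_congr fun j => ?_
        rw [adjoint_inner_right, ← inner_conj_symm, RCLike.enorm_conj]
    _ = ∑' i, ‖P (b i)‖ₑ ^ 2 := by simp only [tsum_enorm_inner_sq]

theorem hsNormSq_eq_tsum (b : HilbertBasis ι ℂ K) (P : K →L[ℂ] L) :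
    hsNormSq P = ∑' i, ‖P (b i)‖ₑ ^ 2 := by
  rw [hsNormSq, ← tsum_enorm_sq_adjoint _ (stdBasis L), ← tsum_enorm_sq_adjoint b (stdBasis L)]

theorem hsNormSq_adjoint (P : K →L[ℂ] L) : hsNormSq (adjoint P) = hsNormSq P :=
  tsum_enorm_sq_adjoint (stdBasis K) (stdBasis L) P

theorem hsNormSq_star (P : K →L[ℂ] K) : hsNormSq (star P) = hsNormSq P := hsNormSq_adjoint P

theorem hsNormSq_mul_ne_top_of_right (P : K →L[ℂ] K) {Q : K →L[ℂ] K} (hQ : hsNormSq Q ≠ ∞) :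
    hsNormSq (P * Q) ≠ ∞ :=
  ne_top_of_le_ne_top (ENNReal.mul_ne_top (by finiteness) hQ) (hsNormSq_comp_le P Q)

theorem hsNormSq_mul_ne_top_of_left {P : K →L[ℂ] K} (hP : hsNormSq P ≠ ∞) (Q : K →L[ℂ] K) :
    hsNormSq (P * Q) ≠ ∞ := by
  rw [← hsNormSq_star, star_mul]
  exact hsNormSq_mul_ne_top_of_right _ (by rwa [hsNormSq_star])

theorem tsum_inner_eq_tsum_inner_adjoint (b : HilbertBasis ι ℂ K) (c : HilbertBasis κ ℂ L)
    {P Q : K →L[ℂ] L} (hP : hsNormSq P ≠ ∞) (hQ : hsNormSq Q ≠ ∞) :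
    ∑' i, ⟪P (b i), Q (b i)⟫_ℂ = ∑' j, ⟪adjoint Q (c j), adjoint P (c j)⟫_ℂ := by
  rw [hsNormSq_eq_tsum b, ← tsum_prod_enorm_inner_sq c] at hP hQ
  have hsum : Summable fun p : ι × κ => ⟪P (b p.1), c p.2⟫_ℂ * ⟪c p.2, Q (b p.1)⟫_ℂ := by
    refine .of_norm_bounded (summable_norm_mul_norm hP hQ) fun p => ?_
    rw [norm_mul, norm_inner_symm]
  calc ∑' i, ⟪P (b i), Q (b i)⟫_ℂ = ∑' i, ∑' j, ⟪P (b i), c j⟫_ℂ * ⟪c j, Q (b i)⟫_ℂ :=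
        tsum_congr fun i => (c.tsum_inner_mul_inner _ _).symm
    _ = ∑' j, ∑' i, ⟪P (b i), c j⟫_ℂ * ⟪c j, Q (b i)⟫_ℂ :=
        (Summable.tsum_comm (f := fun i j => ⟪P (b i), c j⟫_ℂ * ⟪c j, Q (b i)⟫_ℂ) hsum).symm
    _ = ∑' j, ∑' i, ⟪adjoint Q (c j), b i⟫_ℂ * ⟪b i, adjoint P (c j)⟫_ℂ := by
        refine tsum_congr fun j => tsum_congr fun i => ?_
        rw [adjoint_inner_right, adjoint_inner_left, mul_comm]
    _ = ∑' j, ⟪adjoint Q (c j), adjoint P (c j)⟫_ℂ :=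
        tsum_congr fun j => b.tsum_inner_mul_inner _ _

theorem inner_mul_apply (P Q : K →L[ℂ] K) (x : K) :
    ⟪x, (P * Q) x⟫_ℂ = ⟪adjoint P x, Q x⟫_ℂ := by
  rw [mul_apply_eq_comp, adjoint_inner_left]

theorem summable_inner_mul {P Q : K →L[ℂ] K} (hP : hsNormSq P ≠ ∞) (hQ : hsNormSq Q ≠ ∞) :
    Summable fun i => ⟪stdBasis K i, (P * Q) (stdBasis K i)⟫_ℂ := by
  rw [← hsNormSq_adjoint] at hP
  simp only [inner_mul_apply]
  exact .of_norm_bounded (summable_norm_mul_norm hP hQ) fun i => norm_inner_le_norm _ _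

theorem tr_mul_comm {P Q : K →L[ℂ] K} (hP : hsNormSq P ≠ ∞) (hQ : hsNormSq Q ≠ ∞) :
    tr (P * Q) = tr (Q * P) := by
  rw [← hsNormSq_adjoint] at hP
  simp only [tr, inner_mul_apply]
  rw [tsum_inner_eq_tsum_inner_adjoint (stdBasis K) (stdBasis K) hP hQ, adjoint_adjoint]

theorem tendsto_tr_mul {α : Type*} {l : Filter α} {P R : K →L[ℂ] K} {Q : α → K →L[ℂ] K} {c : ℝ}
    (hP : hsNormSq P ≠ ∞) (hR : hsNormSq R ≠ ∞) (hQ : ∀ a, ‖Q a‖ ≤ c)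
    (hlim : Tendsto (fun a => P * Q a) l (𝓝 P)) :
    Tendsto (fun a => tr (P * Q a * R)) l (𝓝 (tr (P * R))) := by
  rw [← hsNormSq_adjoint] at hP
  refine tendsto_tsum_of_dominated_convergence
    ((summable_norm_mul_norm hP hR).mul_left c) (fun i => ?_) (.of_forall fun a i => ?_)
  · exact tendsto_const_nhds.inner
      (((ContinuousLinearMap.apply ℂ K (R (stdBasis K i))).continuous.tendsto P).comp hlim)
  · rw [mul_assoc, inner_mul_apply]
    calc ‖⟪adjoint P (stdBasis K i), (Q a * R) (stdBasis K i)⟫_ℂ‖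
        ≤ ‖adjoint P (stdBasis K i)‖ * (‖Q a‖ * ‖R (stdBasis K i)‖) :=
          (norm_inner_le_norm _ _).trans (by gcongr; exact (Q a).le_opNorm _)
      _ ≤ c * (‖adjoint P (stdBasis K i)‖ * ‖R (stdBasis K i)‖) := by
          rw [mul_left_comm]
          gcongr
          exact hQ a

end HilbertSchmidt

section SandwichTrace

variable {K : Type*} [NormedAddCommGroup K] [InnerProductSpace ℂ K]

theorem re_inner_nonneg {A : K →L[ℂ] K} (hA : 0 ≤ A) (x : K) : 0 ≤ (⟪x, A x⟫_ℂ).re :=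
  ((nonneg_iff_isPositive A).1 hA).re_inner_nonneg_right x

variable [CompleteSpace K]

theorem psdTrace_add {A B : K →L[ℂ] K} (hA : 0 ≤ A) (hB : 0 ≤ B) :
    psdTrace (A + B) = psdTrace A + psdTrace B := by
  rw [psdTrace, psdTrace, psdTrace, ← ENNReal.tsum_add]
  refine tsum_congr fun i => ?_
  rw [add_apply, inner_add_right, Complex.add_re,
    ENNReal.ofReal_add (re_inner_nonneg hA _) (re_inner_nonneg hB _)]

theorem psdTrace_mono {A B : K →L[ℂ] K} (h : A ≤ B) : psdTrace A ≤ psdTrace B := by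
  refine ENNReal.tsum_le_tsum fun i => ENNReal.ofReal_le_ofReal ?_
  have hsub := re_inner_nonneg (sub_nonneg.2 h) (stdBasis K i)
  rwa [sub_apply, inner_sub_right, Complex.sub_re, sub_nonneg] at hsub

theorem psdTrace_smul {c : ℝ} (hc : 0 ≤ c) (A : K →L[ℂ] K) :
    psdTrace (c • A) = ENNReal.ofReal c * psdTrace A := by
  rw [psdTrace, psdTrace, ← ENNReal.tsum_mul_left]
  refine tsum_congr fun i => ?_
  rw [← ENNReal.ofReal_mul hc, FunLike.coe_smul, Pi.smul_apply, ← Complex.coe_smul,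
    inner_smul_right, Complex.re_ofReal_mul]

theorem psdTrace_star_mul_self (P : K →L[ℂ] K) : psdTrace (star P * P) = hsNormSq P := by
  refine tsum_congr fun i => ?_
  rw [inner_mul_apply, star_eq_adjoint, adjoint_adjoint, ← ofReal_norm,
    ← ENNReal.ofReal_pow (norm_nonneg _)]
  exact congrArg _ (inner_self_eq_norm_sq (𝕜 := ℂ) _)

theorem psdTrace_eq_ofReal_re_tr {A : K →L[ℂ] K} (hA : 0 ≤ A)
    (hsum : Summable fun i => ⟪stdBasis K i, A (stdBasis K i)⟫_ℂ) :
    psdTrace A = ENNReal.ofReal (tr A).re := by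
  rw [tr, Complex.re_tsum hsum]
  exact (ENNReal.ofReal_tsum_of_nonneg (fun i => re_inner_nonneg hA _)
    (Complex.hasSum_re hsum.hasSum).summable).symm

theorem re_tr_nonneg {A : K →L[ℂ] K} (hA : 0 ≤ A) : 0 ≤ (tr A).re := by
  by_cases hsum : Summable fun i => ⟪stdBasis K i, A (stdBasis K i)⟫_ℂ
  · rw [tr, Complex.re_tsum hsum]
    exact tsum_nonneg fun i => re_inner_nonneg hA _
  · rw [tr, tsum_eq_zero_of_not_summable hsum, Complex.zero_re]

theorem isSelfAdjoint_sqrt (A : K →L[ℂ] K) : IsSelfAdjoint (CFC.sqrt A) :=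
  .of_nonneg (CFC.sqrt_nonneg A)

theorem psdTrace_eq_hsNormSq_sqrt {A : K →L[ℂ] K} (hA : 0 ≤ A) :
    psdTrace A = hsNormSq (CFC.sqrt A) := by
  rw [← psdTrace_star_mul_self, (isSelfAdjoint_sqrt A).star_eq, CFC.sqrt_mul_sqrt_self A]

theorem sandwichTrace_star_mul_self (P X : K →L[ℂ] K) :
    sandwichTrace (star P * P) X = hsNormSq (P * CFC.sqrt X) := by
  rw [← psdTrace_star_mul_self, star_mul, (isSelfAdjoint_sqrt X).star_eq, sandwichTrace]
  simp only [mul_assoc]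

theorem sandwichTrace_eq_hsNormSq {A : K →L[ℂ] K} (hA : 0 ≤ A) (X : K →L[ℂ] K) :
    sandwichTrace A X = hsNormSq (CFC.sqrt A * CFC.sqrt X) := by
  rw [← sandwichTrace_star_mul_self, (isSelfAdjoint_sqrt A).star_eq, CFC.sqrt_mul_sqrt_self A]

theorem sandwichTrace_comm {A X : K →L[ℂ] K} (hA : 0 ≤ A) (hX : 0 ≤ X) :
    sandwichTrace A X = sandwichTrace X A := by
  rw [sandwichTrace_eq_hsNormSq hA, sandwichTrace_eq_hsNormSq hX, ← hsNormSq_star, star_mul,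
    (isSelfAdjoint_sqrt A).star_eq, (isSelfAdjoint_sqrt X).star_eq]

theorem sandwichTrace_add_left {A B : K →L[ℂ] K} (hA : 0 ≤ A) (hB : 0 ≤ B) (X : K →L[ℂ] K) :
    sandwichTrace (A + B) X = sandwichTrace A X + sandwichTrace B X := by
  rw [sandwichTrace, mul_add, add_mul, psdTrace_add ((isSelfAdjoint_sqrt X).conjugate_nonneg hA)
    ((isSelfAdjoint_sqrt X).conjugate_nonneg hB), sandwichTrace, sandwichTrace]

theorem sandwichTrace_mono_left {A B : K →L[ℂ] K} (h : A ≤ B) (X : K →L[ℂ] K) :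
    sandwichTrace A X ≤ sandwichTrace B X :=
  psdTrace_mono ((isSelfAdjoint_sqrt X).conjugate_le_conjugate h)

theorem sandwichTrace_smul_left {c : ℝ} (hc : 0 ≤ c) (A X : K →L[ℂ] K) :
    sandwichTrace (c • A) X = ENNReal.ofReal c * sandwichTrace A X := by
  rw [sandwichTrace, mul_smul_comm, smul_mul_assoc, psdTrace_smul hc, sandwichTrace]

theorem sandwichTrace_one_left {X : K →L[ℂ] K} (hX : 0 ≤ X) : sandwichTrace 1 X = psdTrace X := by
  rw [sandwichTrace, mul_one, CFC.sqrt_mul_sqrt_self X]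

theorem sandwichTrace_add_right {A X Y : K →L[ℂ] K} (hA : 0 ≤ A) (hX : 0 ≤ X) (hY : 0 ≤ Y) :
    sandwichTrace A (X + Y) = sandwichTrace A X + sandwichTrace A Y := by
  rw [sandwichTrace_comm hA (add_nonneg hX hY), sandwichTrace_add_left hX hY,
    sandwichTrace_comm hX hA, sandwichTrace_comm hY hA]

theorem sandwichTrace_smul_right {c : ℝ} (hc : 0 ≤ c) {A X : K →L[ℂ] K} (hA : 0 ≤ A)
    (hX : 0 ≤ X) : sandwichTrace A (c • X) = ENNReal.ofReal c * sandwichTrace A X := by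
  rw [sandwichTrace_comm hA (smul_nonneg hc hX), sandwichTrace_smul_left hc,
    sandwichTrace_comm hX hA]

theorem sandwichTrace_conj {A X R : K →L[ℂ] K} (hA : 0 ≤ A) (hX : 0 ≤ X) (hR : IsSelfAdjoint R) :
    sandwichTrace A (R * X * R) = sandwichTrace (R * A * R) X := by
  have conj_eq {B : K →L[ℂ] K} (hB : 0 ≤ B) :
      R * B * R = star (CFC.sqrt B * R) * (CFC.sqrt B * R) := by
    rw [star_mul, hR.star_eq, (isSelfAdjoint_sqrt B).star_eq, mul_assoc, mul_assoc,
      ← mul_assoc (CFC.sqrt B), CFC.sqrt_mul_sqrt_self B]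
  rw [sandwichTrace_comm hA (hR.conjugate_nonneg hX), conj_eq hX, conj_eq hA,
    sandwichTrace_star_mul_self, sandwichTrace_star_mul_self, ← hsNormSq_star]
  simp only [star_mul, (isSelfAdjoint_sqrt _).star_eq, hR.star_eq, mul_assoc]

theorem sandwichTrace_ne_top {A X : K →L[ℂ] K} (hA : 0 ≤ A) (hX : 0 ≤ X) (hX' : psdTrace X ≠ ∞) :
    sandwichTrace A X ≠ ∞ := by
  rw [sandwichTrace_eq_hsNormSq hA]
  rw [psdTrace_eq_hsNormSq_sqrt hX] at hX'
  exact hsNormSq_mul_ne_top_of_right _ hX'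

theorem lowerSemicontinuous_psdTrace : LowerSemicontinuous (psdTrace : (K →L[ℂ] K) → ℝ≥0∞) := by
  unfold psdTrace
  exact lowerSemicontinuous_tsum fun i =>
    (ENNReal.continuous_ofReal.comp (by fun_prop)).lowerSemicontinuous

theorem lowerSemicontinuous_sandwichTrace (X : K →L[ℂ] K) :
    LowerSemicontinuous fun A => sandwichTrace A X :=
  lowerSemicontinuous_psdTrace.comp (by fun_prop)

theorem tendsto_sandwichTrace_of_le {α : Type*} {l : Filter α} {A : α → K →L[ℂ] K}
    {B : K →L[ℂ] K} (hlim : Tendsto A l (𝓝 B)) (hle : ∀ a, A a ≤ B) (X : K →L[ℂ] K) :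
    Tendsto (fun a => sandwichTrace (A a) X) l (𝓝 (sandwichTrace B X)) :=
  tendsto_order.2 ⟨fun _ hc => hlim.eventually (lowerSemicontinuous_sandwichTrace X B _ hc),
    fun _ hc => .of_forall fun a => (sandwichTrace_mono_left (hle a) X).trans_lt hc⟩

end SandwichTrace

section Factorization

theorem exists_comp_eq_of_norm_le {𝕜 E F G : Type*} [RCLike 𝕜] [NormedAddCommGroup E]
    [NormedSpace 𝕜 E] [NormedAddCommGroup F] [InnerProductSpace 𝕜 F] [CompleteSpace F]
    [NormedAddCommGroup G] [NormedSpace 𝕜 G] [CompleteSpace G] {S : E →L[𝕜] F} {T : E →L[𝕜] G}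
    (h : ∀ x, ‖T x‖ ≤ ‖S x‖) : ∃ U : F →L[𝕜] G, U ∘L S = T := by
  let V : Submodule 𝕜 F := S.range.topologicalClosure
  have hV (x : E) : S x ∈ V := S.range.le_topologicalClosure ⟨x, rfl⟩
  have : CompleteSpace V := S.range.isClosed_topologicalClosure.completeSpace_coe
  let S' : E →ₗ[𝕜] V := S.toLinearMap.codRestrict V hV
  have hdense : DenseRange S' := by
    refine Subtype.dense_iff.2 fun y hy => ?_
    rwa [← Set.range_comp]
  refine ⟨T.toLinearMap.extendOfNorm S' ∘L V.orthogonalProjectionOnto, ?_⟩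
  ext x
  have hproj : V.orthogonalProjectionOnto (S x) = S' x :=
    Submodule.orthogonalProjectionOnto_mem_subspace_eq_self (S' x)
  rw [comp_apply, comp_apply, hproj]
  exact LinearMap.extendOfNorm_eq hdense ⟨1, fun x => by simpa [S'] using h x⟩ x

end Factorization

section TraceClass

theorem norm_sqrt_abs_mul_sq_le {𝔄 : Type*} [CStarAlgebra 𝔄] [PartialOrder 𝔄] [StarOrderedRing 𝔄]
    (T R : 𝔄) : ‖CFC.sqrt (CFC.abs T) * R‖ ^ 2 ≤ ‖R‖ * ‖T * R‖ := by
  have hnorm : ‖CFC.abs T * R‖ = ‖T * R‖ := by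
    refine (sq_eq_sq₀ (norm_nonneg _) (norm_nonneg _)).1 ?_
    rw [sq, sq, ← CStarRing.norm_star_mul_self, ← CStarRing.norm_star_mul_self, star_mul, star_mul,
      (IsSelfAdjoint.of_nonneg (CFC.abs_nonneg T)).star_eq, mul_assoc, mul_assoc,
      ← mul_assoc (CFC.abs T), CFC.abs_mul_abs, mul_assoc]
  calc ‖CFC.sqrt (CFC.abs T) * R‖ ^ 2 = ‖star R * (CFC.abs T * R)‖ := by
        rw [sq, ← CStarRing.norm_star_mul_self, star_mul,
          (IsSelfAdjoint.of_nonneg (CFC.sqrt_nonneg (CFC.abs T))).star_eq, mul_assoc,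
          ← mul_assoc (CFC.sqrt (CFC.abs T)), CFC.sqrt_mul_sqrt_self _ (CFC.abs_nonneg T)]
    _ ≤ ‖R‖ * ‖T * R‖ := by
        rw [← hnorm, ← norm_star R]
        exact norm_mul_le _ _

theorem tendsto_sqrt_abs_mul {𝔄 α : Type*} [CStarAlgebra 𝔄] [PartialOrder 𝔄] [StarOrderedRing 𝔄]
    {T : 𝔄} {R : α → 𝔄} {l : Filter α} {c : ℝ} (hR : ∀ a, ‖R a‖ ≤ c)
    (hlim : Tendsto (fun a => T * R a) l (𝓝 T)) :
    Tendsto (fun a => CFC.sqrt (CFC.abs T) * R a) l (𝓝 (CFC.sqrt (CFC.abs T))) := by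
  have hbound (a : α) : ‖CFC.sqrt (CFC.abs T) * R a - CFC.sqrt (CFC.abs T)‖ ^ 2 ≤
      (c + ‖(1 : 𝔄)‖) * ‖T * R a - T‖ := by
    calc ‖CFC.sqrt (CFC.abs T) * R a - CFC.sqrt (CFC.abs T)‖ ^ 2
        = ‖CFC.sqrt (CFC.abs T) * (R a - 1)‖ ^ 2 := by rw [mul_sub, mul_one]
      _ ≤ ‖R a - 1‖ * ‖T * (R a - 1)‖ := norm_sqrt_abs_mul_sq_le T _
      _ ≤ (c + ‖(1 : 𝔄)‖) * ‖T * R a - T‖ := by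
        rw [mul_sub T, mul_one]
        gcongr
        exact (norm_sub_le _ _).trans (by gcongr; exact hR a)
  have hzero : Tendsto (fun a => (c + ‖(1 : 𝔄)‖) * ‖T * R a - T‖) l (𝓝 0) := by
    simpa using (tendsto_iff_norm_sub_tendsto_zero.1 hlim).const_mul (c + ‖(1 : 𝔄)‖)
  refine tendsto_iff_norm_sub_tendsto_zero.2 ?_
  simpa using (squeeze_zero (fun _ => sq_nonneg _) hbound hzero).sqrt

theorem exists_nonneg_approx_inverse {𝔄 : Type*} [CStarAlgebra 𝔄] [PartialOrder 𝔄]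
    [StarOrderedRing 𝔄] {X : 𝔄} (hX : 0 ≤ X) {ε : ℝ} (hε : 0 < ε) :
    ∃ G : 𝔄, 0 ≤ G ∧ ‖G * X‖ ≤ 1 ∧ X * G * X ≤ X ∧ ‖X * G * X - X‖ ≤ ε := by
  have hnonneg {x : ℝ} (hx : x ∈ spectrum ℝ X) : 0 ≤ x := spectrum_nonneg_of_nonneg hX hx
  have hcont : ContinuousOn (fun x : ℝ => (x + ε)⁻¹) (spectrum ℝ X) :=
    ContinuousOn.inv₀ (by fun_prop) fun x hx => by linarith [hnonneg hx]
  have hbounds {x : ℝ} (hx : x ∈ spectrum ℝ X) : 0 ≤ (x + ε)⁻¹ * x ∧ (x + ε)⁻¹ * x ≤ 1 := by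
    have hx0 := hnonneg hx
    refine ⟨by positivity, ?_⟩
    rw [inv_mul_le_one₀ (by positivity)]
    linarith
  have hid : cfc (fun x : ℝ => x) X = X := cfc_id' ℝ X
  have hGX : cfc (fun x : ℝ => (x + ε)⁻¹) X * X = cfc (fun x : ℝ => (x + ε)⁻¹ * x) X := by
    rw [cfc_mul _ _ X, hid]
  have hXGX : X * cfc (fun x : ℝ => (x + ε)⁻¹) X * X =
      cfc (fun x : ℝ => x * ((x + ε)⁻¹ * x)) X := by
    rw [mul_assoc, hGX, cfc_mul (fun x : ℝ => x) (fun x : ℝ => (x + ε)⁻¹ * x) X, hid]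
  refine ⟨cfc (fun x : ℝ => (x + ε)⁻¹) X, cfc_nonneg fun x hx => ?_, ?_, ?_, ?_⟩
  · have hx0 := hnonneg hx
    positivity
  · rw [hGX]
    refine norm_cfc_le zero_le_one fun x hx => ?_
    rw [Real.norm_of_nonneg (hbounds hx).1]
    exact (hbounds hx).2
  · rw [hXGX]
    nth_rw 2 [← hid]
    exact cfc_mono fun x hx => mul_le_of_le_one_right (hnonneg hx) (hbounds hx).2
  · rw [hXGX]
    nth_rw 2 [← hid]
    rw [← cfc_sub _ _ X]
    refine norm_cfc_le hε.le fun x hx => ?_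
    have hsub : x * ((x + ε)⁻¹ * x) - x = -(ε * ((x + ε)⁻¹ * x)) := by
      have hx0 := hnonneg hx
      field_simp
      ring
    rw [hsub, norm_neg, Real.norm_of_nonneg (mul_nonneg hε.le (hbounds hx).1)]
    exact mul_le_of_le_one_right hε.le (hbounds hx).2

variable {K : Type*} [NormedAddCommGroup K] [InnerProductSpace ℂ K] [CompleteSpace K]

theorem IsTraceClass.exists_mul_sqrt_abs_eq {T : K →L[ℂ] K} (hT : IsTraceClass T) :
    hsNormSq (CFC.sqrt (CFC.abs T)) ≠ ∞ ∧
      ∃ W : K →L[ℂ] K, hsNormSq W ≠ ∞ ∧ W * CFC.sqrt (CFC.abs T) = T := by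
  have hS : hsNormSq (CFC.sqrt (CFC.abs T)) ≠ ∞ := by
    rw [← psdTrace_eq_hsNormSq_sqrt (CFC.abs_nonneg T)]
    exact hT.ne
  have hnorm (x : K) : ‖T x‖ ≤ ‖CFC.abs T x‖ := by
    have habs : (adjoint (CFC.abs T) ∘L CFC.abs T) = adjoint T ∘L T := by
      rw [← star_eq_adjoint, (IsSelfAdjoint.of_nonneg (CFC.abs_nonneg T)).star_eq]
      exact CFC.abs_mul_abs T
    rw [apply_norm_eq_sqrt_inner_adjoint_left, apply_norm_eq_sqrt_inner_adjoint_left (CFC.abs T),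
      habs]
  obtain ⟨U, hU⟩ := exists_comp_eq_of_norm_le hnorm
  refine ⟨hS, U * CFC.sqrt (CFC.abs T), hsNormSq_mul_ne_top_of_right U hS, ?_⟩
  rw [mul_assoc, CFC.sqrt_mul_sqrt_self _ (CFC.abs_nonneg T)]
  exact hU

theorem psdTrace_mul_eq_ofReal_re_tr {P Q : K →L[ℂ] K} (hP : hsNormSq P ≠ ∞) (hQ : hsNormSq Q ≠ ∞)
    (hPQ : 0 ≤ P * Q) :
    psdTrace (P * Q) = ENNReal.ofReal (tr (Q * P)).re ∧ 0 ≤ (tr (Q * P)).re := by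
  rw [← tr_mul_comm hP hQ]
  exact ⟨psdTrace_eq_ofReal_re_tr hPQ (summable_inner_mul hP hQ), re_tr_nonneg hPQ⟩

theorem sandwichTrace_eq_ofReal_re_tr {Z ρ : K →L[ℂ] K} (hZ : 0 ≤ Z) (hρ : 0 ≤ ρ)
    (hρ' : psdTrace ρ ≠ ∞) :
    sandwichTrace Z ρ = ENNReal.ofReal (tr (ρ * Z)).re ∧ 0 ≤ (tr (ρ * Z)).re := by
  rw [psdTrace_eq_hsNormSq_sqrt hρ] at hρ'
  have hcyc : tr (ρ * Z) = tr (CFC.sqrt ρ * (CFC.sqrt ρ * Z)) := by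
    rw [← mul_assoc, CFC.sqrt_mul_sqrt_self ρ]
  rw [hcyc, tr_mul_comm hρ' (hsNormSq_mul_ne_top_of_left hρ' Z), sandwichTrace]
  have hpos := (isSelfAdjoint_sqrt ρ).conjugate_nonneg hZ
  exact ⟨psdTrace_eq_ofReal_re_tr hpos (summable_inner_mul (hsNormSq_mul_ne_top_of_left hρ' Z) hρ'),
    re_tr_nonneg hpos⟩

/-- Both sides are computed from the products `√B X · G X √B` and `G X √B · √B X` of
Hilbert-Schmidt operators, which need not exist without the factors `X` and `G X`. -/
theorem sandwichTrace_mul_mul_eq {B X G S W : K →L[ℂ] K} (hB : 0 ≤ B) (hX : 0 ≤ X) (hG : 0 ≤ G)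
    (hS : hsNormSq S ≠ ∞) (hW : hsNormSq W ≠ ∞) (hWS : W * S = B * X) :
    sandwichTrace (X * G * X) B = ENNReal.ofReal (tr (S * (G * X) * W)).re ∧
      0 ≤ (tr (S * (G * X) * W)).re := by
  have hXsa : IsSelfAdjoint X := .of_nonneg hX
  have hBB : CFC.sqrt B * CFC.sqrt B = B := CFC.sqrt_mul_sqrt_self B
  have hBX : hsNormSq (CFC.sqrt B * X) ≠ ∞ := by
    have hXBX : star (CFC.sqrt B * X) * (CFC.sqrt B * X) = X * W * S := by
      rw [star_mul, hXsa.star_eq, (isSelfAdjoint_sqrt B).star_eq, mul_assoc,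
        ← mul_assoc (CFC.sqrt B), hBB, ← hWS, mul_assoc]
    rw [← psdTrace_star_mul_self, hXBX, (psdTrace_mul_eq_ofReal_re_tr
      (hsNormSq_mul_ne_top_of_right X hW) hS (hXBX ▸ star_mul_self_nonneg _)).1]
    exact ENNReal.ofReal_ne_top
  have hGXB : hsNormSq (G * (X * CFC.sqrt B)) ≠ ∞ := by
    refine hsNormSq_mul_ne_top_of_right G ?_
    rwa [← hsNormSq_star, star_mul, hXsa.star_eq, (isSelfAdjoint_sqrt B).star_eq]
  have hprod : CFC.sqrt B * (X * G * X) * CFC.sqrt B =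
      CFC.sqrt B * X * (G * (X * CFC.sqrt B)) := by simp only [mul_assoc]
  have htr : tr (G * (X * CFC.sqrt B) * (CFC.sqrt B * X)) = tr (S * (G * X) * W) := by
    rw [mul_assoc S, tr_mul_comm hS (hsNormSq_mul_ne_top_of_right _ hW), mul_assoc _ W, hWS,
      mul_assoc, mul_assoc X, ← mul_assoc (CFC.sqrt B), hBB, mul_assoc]
  rw [sandwichTrace, ← htr, hprod]
  exact psdTrace_mul_eq_ofReal_re_tr hBX hGXB
    (hprod ▸ (isSelfAdjoint_sqrt B).conjugate_nonneg (hXsa.conjugate_nonneg hG))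

theorem IsTraceClass.sandwichTrace_eq {B X : K →L[ℂ] K} (hT : IsTraceClass (B * X)) (hB : 0 ≤ B)
    (hX : 0 ≤ X) :
    sandwichTrace B X = ENNReal.ofReal (tr (B * X)).re ∧ 0 ≤ (tr (B * X)).re := by
  obtain ⟨hS, W, hW, hWS⟩ := hT.exists_mul_sqrt_abs_eq
  set S := CFC.sqrt (CFC.abs (B * X))
  choose G hG hGX hle hnear using fun n : ℕ =>
    exists_nonneg_approx_inverse hX (Nat.one_div_pos_of_nat (α := ℝ) (n := n))
  have hXlim : Tendsto (fun n => X * G n * X) atTop (𝓝 X) :=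
    tendsto_iff_norm_sub_tendsto_zero.2 <|
      squeeze_zero (fun _ => norm_nonneg _) hnear tendsto_one_div_add_atTop_nhds_zero_nat
  have hTlim : Tendsto (fun n => B * X * (G n * X)) atTop (𝓝 (B * X)) := by
    simpa only [mul_assoc] using hXlim.const_mul B
  have hSlim := tendsto_sqrt_abs_mul hGX hTlim
  have htr := tendsto_tr_mul hS hW hGX hSlim
  rw [tr_mul_comm hS hW, hWS] at htr
  have hre := (Complex.continuous_re.tendsto _).comp htr
  have happrox (n : ℕ) := sandwichTrace_mul_mul_eq hB hX (hG n) hS hW hWS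
  refine ⟨?_, ge_of_tendsto' hre fun n => (happrox n).2⟩
  rw [sandwichTrace_comm hB hX]
  refine tendsto_nhds_unique (tendsto_sandwichTrace_of_le hXlim hle B) ?_
  simp only [(happrox _).1]
  exact (ENNReal.continuous_ofReal.tendsto _).comp hre

end TraceClass

section Completion

variable {E F : Type*} [NormedAddCommGroup E] [InnerProductSpace ℂ E]
  [NormedAddCommGroup F] [InnerProductSpace ℂ F]

theorem completion_ext {f g : Completion E →L[ℂ] F} (h : ∀ x : E, f x = g x) : f = g := by
  ext x
  induction x using Completion.induction_on with
  | hp => exact isClosed_eq f.continuous g.continuous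
  | ih x => exact h x

theorem norm_completion_le (f : E →L[ℂ] E) : ‖f.completion‖ ≤ ‖f‖ := by
  refine opNorm_le_bound _ (norm_nonneg _) fun x => ?_
  induction x using Completion.induction_on with
  | hp => exact isClosed_le (by fun_prop) (by fun_prop)
  | ih x =>
    rw [completion_apply_coe, Completion.norm_coe, Completion.norm_coe]
    exact f.le_opNorm x

theorem continuous_completion :
    Continuous (ContinuousLinearMap.completion : (E →L[ℂ] E) → _) := by
  have hsub : ∀ f g : E →L[ℂ] E, f.completion - g.completion = (f - g).completion := fun f g =>
    completion_ext fun x => by simp [← Completion.coe_sub]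
  refine (LipschitzWith.of_dist_le_mul (K := 1) fun f g => ?_).continuous
  rw [dist_eq_norm, dist_eq_norm, hsub, NNReal.coe_one, one_mul]
  exact norm_completion_le _

theorem star_completion {f g : E →L[ℂ] E} (h : ∀ x y, ⟪f x, y⟫_ℂ = ⟪x, g y⟫_ℂ) :
    star f.completion = g.completion := by
  symm
  rw [star_eq_adjoint, eq_adjoint_iff]
  intro x y
  induction x, y using Completion.induction_on₂ with
  | hp => exact isClosed_eq (by fun_prop) (by fun_prop)
  | ih x y =>
    rw [completion_apply_coe, completion_apply_coe, Completion.inner_coe, Completion.inner_coe,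
      ← inner_conj_symm, ← h, inner_conj_symm]

theorem inner_mapL {S S' : E →L[ℂ] E} {T T' : F →L[ℂ] F} (hS : ∀ x y, ⟪S x, y⟫_ℂ = ⟪x, S' y⟫_ℂ)
    (hT : ∀ x y, ⟪T x, y⟫_ℂ = ⟪x, T' y⟫_ℂ) (x y : E ⊗[ℂ] F) :
    ⟪TensorProduct.mapL S T x, y⟫_ℂ = ⟪x, TensorProduct.mapL S' T' y⟫_ℂ := by
  induction x using TensorProduct.induction_on with
  | zero => simp only [map_zero, inner_zero_left]
  | add x₁ x₂ h₁ h₂ => rw [map_add, inner_add_left, inner_add_left, h₁, h₂]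
  | tmul a b =>
    induction y using TensorProduct.induction_on with
    | zero => simp only [map_zero, inner_zero_right]
    | add y₁ y₂ h₁ h₂ => rw [map_add, inner_add_right, inner_add_right, h₁, h₂]
    | tmul c d =>
      rw [TensorProduct.mapL_tmul, TensorProduct.mapL_tmul, TensorProduct.inner_tmul,
        TensorProduct.inner_tmul, hS, hT]

theorem continuous_mapL {Y : Type*} [TopologicalSpace Y] {f : Y → E →L[ℂ] E} {g : Y → F →L[ℂ] F}
    (hf : Continuous f) (hg : Continuous g) :
    Continuous fun y => TensorProduct.mapL (f y) (g y) := by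
  have h1 : Continuous fun f : E →L[ℂ] E => f.rTensor F := by
    have h : LipschitzWith 1 fun f : E →L[ℂ] E => f.rTensor F := by
      refine LipschitzWith.of_dist_le_mul fun f g => ?_
      rw [dist_eq_norm, dist_eq_norm, ← rTensor_sub, NNReal.coe_one, one_mul]
      exact norm_rTensor_le F (f - g)
    exact h.continuous
  have h2 : Continuous fun g : F →L[ℂ] F => g.lTensor E := by
    have h : LipschitzWith 1 fun f : F →L[ℂ] F => f.lTensor E := by
      refine LipschitzWith.of_dist_le_mul fun f g => ?_
      rw [dist_eq_norm, dist_eq_norm, ← lTensor_sub, NNReal.coe_one, one_mul]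
      exact norm_lTensor_le E (f - g)
    exact h.continuous
  exact (h1.comp hf).clm_comp (h2.comp hg)

end Completion

section Pow

variable {H : Type u} [NormedAddCommGroup H] [InnerProductSpace ℂ H]

theorem algOpPow_succ_apply (A : H →L[ℂ] H) (n : ℕ) (x : AlgPow H n ⊗[ℂ] H) :
    algOpPow A (n + 1) ((algSucc H n).symm x) =
      (algSucc H n).symm (TensorProduct.mapL (algOpPow A n) A x) := rfl

theorem algOpPow_mul_apply (A B : H →L[ℂ] H) (n : ℕ) (x : AlgPow H n) :
    algOpPow (A * B) n x = algOpPow A n (algOpPow B n x) := by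
  induction n with
  | zero => rfl
  | succ n ih =>
    obtain ⟨x, rfl⟩ := (algSucc H n).symm.surjective x
    rw [algOpPow_succ_apply, algOpPow_succ_apply, algOpPow_succ_apply]
    have : algOpPow (A * B) n = algOpPow A n ∘L algOpPow B n := by
      ext x
      exact ih x
    rw [this]
    congr 1
    exact congrArg (fun f : AlgPow H n ⊗[ℂ] H →L[ℂ] AlgPow H n ⊗[ℂ] H => f x)
      (TensorProduct.mapL_comp (algOpPow A n) (algOpPow B n) A B)

theorem opPow_mul (A B : H →L[ℂ] H) (n : ℕ) : opPow (A * B) n = opPow A n * opPow B n :=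
  completion_ext fun x => by
    rw [mul_apply_eq_comp, opPow, opPow, opPow, completion_apply_coe, completion_apply_coe,
      completion_apply_coe, algOpPow_mul_apply]

theorem continuous_opPow {Y : Type*} [TopologicalSpace Y] {A : Y → H →L[ℂ] H} (hA : Continuous A)
    (n : ℕ) : Continuous fun y => opPow (A y) n := by
  refine continuous_completion.comp ?_
  induction n with
  | zero => exact continuous_const
  | succ n ih => exact continuous_const.clm_comp ((continuous_mapL ih hA).clm_comp continuous_const)

variable [CompleteSpace H]

theorem opPow_star (A : H →L[ℂ] H) (n : ℕ) : opPow (star A) n = star (opPow A n) := by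
  refine (star_completion ?_).symm
  induction n with
  | zero => exact fun x y => rfl
  | succ n ih =>
    intro x y
    obtain ⟨x, rfl⟩ := (algSucc H n).symm.surjective x
    obtain ⟨y, rfl⟩ := (algSucc H n).symm.surjective y
    rw [algOpPow_succ_apply, algOpPow_succ_apply, LinearIsometryEquiv.inner_map_map,
      LinearIsometryEquiv.inner_map_map]
    exact inner_mapL ih (fun x y => by rw [star_eq_adjoint, adjoint_inner_right]) x y

theorem opPow_nonneg {A : H →L[ℂ] H} (hA : 0 ≤ A) (n : ℕ) : 0 ≤ opPow A n := by
  rw [← CFC.sqrt_mul_sqrt_self A hA, opPow_mul]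
  conv_rhs => enter [1]; rw [← (isSelfAdjoint_sqrt A).star_eq, opPow_star]
  exact star_mul_self_nonneg _

end Pow

section Append

variable {H : Type u} [NormedAddCommGroup H] [InnerProductSpace ℂ H] {n m : ℕ}

variable (n m) in
/-- The elementary tensor `x ⊗ y ∈ H^{⊗ (n+m)}` of `x ∈ H^{⊗ n}` and `y ∈ H^{⊗ m}`, as a bounded
bilinear map; it turns statements about `powTensor` into statements about vectors. -/
noncomputable def powTmul : HilbertPow H n →L[ℂ] HilbertPow H m →L[ℂ] HilbertPow H (n + m) :=
  compL ℂ _ _ _ ((append H n m : _ →L[ℂ] HilbertPow H (n + m)) ∘L Completion.toComplL) ∘L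
    TensorProduct.mkL ℂ (HilbertPow H n) (HilbertPow H m)

theorem powTmul_apply (x : HilbertPow H n) (y : HilbertPow H m) :
    powTmul n m x y = append H n m ((x ⊗ₜ[ℂ] y : HilbertPow H n ⊗[ℂ] HilbertPow H m) :
      HTensor (HilbertPow H n) (HilbertPow H m)) := rfl

theorem inner_powTmul (x x' : HilbertPow H n) (y y' : HilbertPow H m) :
    ⟪powTmul n m x y, powTmul n m x' y'⟫_ℂ = ⟪x, x'⟫_ℂ * ⟪y, y'⟫_ℂ := by
  rw [powTmul_apply, powTmul_apply, LinearIsometryEquiv.inner_map_map, Completion.inner_coe,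
    TensorProduct.inner_tmul]

theorem enorm_powTmul (x : HilbertPow H n) (y : HilbertPow H m) :
    ‖powTmul n m x y‖ₑ = ‖x‖ₑ * ‖y‖ₑ := by
  rw [powTmul_apply, LinearIsometryEquiv.enorm_map, Completion.enorm_coe, TensorProduct.enorm_tmul]

theorem powTensor_powTmul (S : HilbertPow H n →L[ℂ] HilbertPow H n)
    (T : HilbertPow H m →L[ℂ] HilbertPow H m) (x : HilbertPow H n) (y : HilbertPow H m) :
    powTensor S T (powTmul n m x y) = powTmul n m (S x) (T y) := by
  rw [powTmul_apply, powTmul_apply]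
  change append H n m (opTensor S T ((append H n m).symm (append H n m _))) = _
  rw [LinearIsometryEquiv.symm_apply_apply, opTensor, completion_apply_coe,
    TensorProduct.mapL_tmul]

theorem powTmul_coe (x : AlgPow H n) (y : AlgPow H m) :
    powTmul n m (x : HilbertPow H n) (y : HilbertPow H m) =
      ((algAppend H n m (x ⊗ₜ y) : AlgPow H (n + m)) : HilbertPow H (n + m)) := by
  have h := LinearEquiv.extendOfIsometry_eq (f := (algAppend H n m).toLinearEquiv)
    (e₁ := (toHTensor (AlgPow H n) (AlgPow H m)).toLinearMap)
    (e₂ := (Completion.toComplₗᵢ (𝕜 := ℂ) (E := AlgPow H (n + m))).toLinearMap)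
    (denseRange_toHTensor _ _) Completion.denseRange_coe (by intro x; simp) (x ⊗ₜ y)
  exact h

theorem algAppend_succ_tmul (x : AlgPow H n) (y : AlgPow H m) (h : H) :
    algAppend H n (m + 1) (x ⊗ₜ ((algSucc H m).symm (y ⊗ₜ h))) =
      (algSucc H (n + m)).symm (algAppend H n m (x ⊗ₜ y) ⊗ₜ h) := rfl

theorem algOpPow_algAppend (A : H →L[ℂ] H) (n m : ℕ) (x : AlgPow H n) (y : AlgPow H m) :
    algOpPow A (n + m) (algAppend H n m (x ⊗ₜ y)) =
      algAppend H n m (algOpPow A n x ⊗ₜ algOpPow A m y) := by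
  induction m with
  | zero =>
    have h : ∀ z : AlgPow H n, algAppend H n 0 (z ⊗ₜ y) = algZero H y • z := fun z => rfl
    have h2 : algOpPow A 0 y = y := rfl
    rw [h2, h, h]
    exact map_smul (algOpPow A n) _ _
  | succ m ih =>
    obtain ⟨y, rfl⟩ := (algSucc H m).symm.surjective y
    induction y using TensorProduct.induction_on with
    | zero => simp only [map_zero, TensorProduct.tmul_zero]
    | add y₁ y₂ h₁ h₂ => simp only [map_add, TensorProduct.tmul_add, h₁, h₂]
    | tmul y h =>
      rw [algAppend_succ_tmul, algOpPow_succ_apply, TensorProduct.mapL_tmul, algAppend_succ_tmul,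
        ← ih]
      exact algOpPow_succ_apply A (n + m) (algAppend H n m (x ⊗ₜ y) ⊗ₜ h)

theorem opPow_powTmul (A : H →L[ℂ] H) (x : HilbertPow H n) (y : HilbertPow H m) :
    opPow A (n + m) (powTmul n m x y) = powTmul n m (opPow A n x) (opPow A m y) := by
  induction x, y using Completion.induction_on₂ with
  | hp =>
    exact isClosed_eq (by fun_prop) (by fun_prop)
  | ih x y =>
    rw [powTmul_coe, opPow, opPow, opPow, completion_apply_coe, completion_apply_coe,
      completion_apply_coe, powTmul_coe, algOpPow_algAppend]

theorem mem_of_powTmul_mem {V : Submodule ℂ (HilbertPow H (n + m))}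
    (hV : IsClosed (V : Set (HilbertPow H (n + m)))) (h : ∀ x y, powTmul n m x y ∈ V)
    (z : HilbertPow H (n + m)) : z ∈ V := by
  obtain ⟨z, rfl⟩ := (append H n m).surjective z
  induction z using Completion.induction_on with
  | hp => exact hV.preimage (append H n m).continuous
  | ih z =>
    induction z using TensorProduct.induction_on with
    | zero => simp [Completion.coe_zero]
    | add x y hx hy => rw [Completion.coe_add, map_add]; exact V.add_mem hx hy
    | tmul x y => exact h x y

theorem powTmul_ext {f g : HilbertPow H (n + m) →L[ℂ] HilbertPow H (n + m)}
    (h : ∀ x y, f (powTmul n m x y) = g (powTmul n m x y)) : f = g := by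
  ext z
  have := mem_of_powTmul_mem (V := LinearMap.ker (f - g).toLinearMap) (f - g).isClosed_ker
    (fun x y => by simp [h]) z
  simpa [sub_eq_zero] using this

theorem opPow_add (A : H →L[ℂ] H) (n m : ℕ) :
    opPow A (n + m) = powTensor (opPow A n) (opPow A m) :=
  powTmul_ext fun x y => by rw [opPow_powTmul, powTensor_powTmul]

theorem powTensor_mul (S S' : HilbertPow H n →L[ℂ] HilbertPow H n)
    (T T' : HilbertPow H m →L[ℂ] HilbertPow H m) :
    powTensor S T * powTensor S' T' = powTensor (S * S') (T * T') :=
  powTmul_ext fun x y => by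
    simp only [mul_apply_eq_comp, powTensor_powTmul]

theorem powTensor_one : powTensor (1 : HilbertPow H n →L[ℂ] HilbertPow H n)
    (1 : HilbertPow H m →L[ℂ] HilbertPow H m) = 1 :=
  powTmul_ext fun x y => by simp only [powTensor_powTmul, one_apply_eq_self]

theorem star_powTensor (S : HilbertPow H n →L[ℂ] HilbertPow H n)
    (T : HilbertPow H m →L[ℂ] HilbertPow H m) :
    star (powTensor S T) = powTensor (star S) (star T) := by
  have h1 : star (opTensor S T) = opTensor (star S) (star T) :=
    star_completion (inner_mapL (fun x y => by rw [star_eq_adjoint, adjoint_inner_right])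
      (fun x y => by rw [star_eq_adjoint, adjoint_inner_right]))
  symm
  refine (eq_adjoint_iff _ _).2 fun x y => ?_
  obtain ⟨x, rfl⟩ := (append H n m).surjective x
  obtain ⟨y, rfl⟩ := (append H n m).surjective y
  change ⟪append H n m (opTensor (star S) (star T) ((append H n m).symm (append H n m x))), _⟫_ℂ =
    ⟪_, append H n m (opTensor S T ((append H n m).symm (append H n m y)))⟫_ℂ
  rw [LinearIsometryEquiv.symm_apply_apply, LinearIsometryEquiv.symm_apply_apply,
    LinearIsometryEquiv.inner_map_map, LinearIsometryEquiv.inner_map_map, ← h1, star_eq_adjoint,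
    adjoint_inner_left]

theorem powTensor_nonneg {S : HilbertPow H n →L[ℂ] HilbertPow H n}
    {T : HilbertPow H m →L[ℂ] HilbertPow H m} (hS : 0 ≤ S) (hT : 0 ≤ T) : 0 ≤ powTensor S T := by
  rw [← CFC.sqrt_mul_sqrt_self S, ← CFC.sqrt_mul_sqrt_self T, ← powTensor_mul]
  conv_rhs =>
    enter [1]
    rw [← (isSelfAdjoint_sqrt S).star_eq, ← (isSelfAdjoint_sqrt T).star_eq, ← star_powTensor]
  exact star_mul_self_nonneg _

theorem sqrt_powTensor {S : HilbertPow H n →L[ℂ] HilbertPow H n}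
    {T : HilbertPow H m →L[ℂ] HilbertPow H m} (hS : 0 ≤ S) (hT : 0 ≤ T) :
    CFC.sqrt (powTensor S T) = powTensor (CFC.sqrt S) (CFC.sqrt T) := by
  refine CFC.sqrt_unique ?_ (powTensor_nonneg (CFC.sqrt_nonneg S) (CFC.sqrt_nonneg T))
  rw [powTensor_mul, CFC.sqrt_mul_sqrt_self S, CFC.sqrt_mul_sqrt_self T]

theorem mem_of_forall_basis_mem {E F ι : Type*} [NormedAddCommGroup E] [InnerProductSpace ℂ E]
    [NormedAddCommGroup F] [InnerProductSpace ℂ F] (b : HilbertBasis ι ℂ E) (f : E →L[ℂ] F)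
    {V : Submodule ℂ F} (hV : IsClosed (V : Set F)) (h : ∀ i, f (b i) ∈ V) (x : E) : f x ∈ V := by
  have hle : (Submodule.span ℂ (Set.range b)).topologicalClosure ≤ V.comap f.toLinearMap :=
    Submodule.topologicalClosure_minimal _
      (Submodule.span_le.2 (Set.range_subset_iff.2 h)) (hV.preimage f.continuous)
  rw [b.dense_span] at hle
  exact hle (Submodule.mem_top (x := x))

theorem orthonormal_powTmul {ι κ : Type*} {b : ι → HilbertPow H n} {c : κ → HilbertPow H m}
    (hb : Orthonormal ℂ b) (hc : Orthonormal ℂ c) :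
    Orthonormal ℂ fun p : ι × κ => powTmul n m (b p.1) (c p.2) := by
  classical
  rw [orthonormal_iff_ite] at hb hc ⊢
  rintro ⟨i₁, i₂⟩ ⟨j₁, j₂⟩
  simp [inner_powTmul, hb, hc, ← ite_and, and_comm]

/-- The Hilbert basis of `H^{⊗ (n+m)}` formed by the elementary tensors of two Hilbert bases, used
to compute Hilbert-Schmidt norms of `powTensor`. -/
noncomputable def powTmulBasis {ι κ : Type*} (b : HilbertBasis ι ℂ (HilbertPow H n))
    (c : HilbertBasis κ ℂ (HilbertPow H m)) : HilbertBasis (ι × κ) ℂ (HilbertPow H (n + m)) :=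
  HilbertBasis.mk (orthonormal_powTmul b.orthonormal c.orthonormal) fun z _ =>
    have hV := Submodule.isClosed_topologicalClosure
      (Submodule.span ℂ (Set.range fun p : ι × κ => powTmul n m (b p.1) (c p.2)))
    mem_of_powTmul_mem hV
      (fun x y => mem_of_forall_basis_mem c (powTmul n m x) hV
        (fun j => mem_of_forall_basis_mem b ((powTmul n m).flip (c j)) hV
          (fun i => Submodule.le_topologicalClosure _ (Submodule.subset_span ⟨(i, j), rfl⟩)) x) y) z

theorem powTmulBasis_apply {ι κ : Type*} (b : HilbertBasis ι ℂ (HilbertPow H n))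
    (c : HilbertBasis κ ℂ (HilbertPow H m)) (p : ι × κ) :
    powTmulBasis b c p = powTmul n m (b p.1) (c p.2) := by
  rw [powTmulBasis, HilbertBasis.coe_mk]

theorem hsNormSq_powTensor (S : HilbertPow H n →L[ℂ] HilbertPow H n)
    (T : HilbertPow H m →L[ℂ] HilbertPow H m) :
    hsNormSq (powTensor S T) = hsNormSq S * hsNormSq T := by
  rw [hsNormSq_eq_tsum (powTmulBasis (stdBasis _) (stdBasis _)), hsNormSq, hsNormSq,
    ← ENNReal.tsum_mul_right]
  simp only [powTmulBasis_apply, powTensor_powTmul, enorm_powTmul, ← ENNReal.tsum_mul_left, mul_pow]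
  exact ENNReal.tsum_prod (f := fun i j => ‖S (stdBasis (HilbertPow H n) i)‖ₑ ^ 2 *
    ‖T (stdBasis (HilbertPow H m) j)‖ₑ ^ 2)

theorem sandwichTrace_powTensor [CompleteSpace H] {A : H →L[ℂ] H} (hA : 0 ≤ A)
    {X : HilbertPow H n →L[ℂ] HilbertPow H n} {Y : HilbertPow H m →L[ℂ] HilbertPow H m}
    (hX : 0 ≤ X) (hY : 0 ≤ Y) :
    sandwichTrace (opPow A (n + m)) (powTensor X Y) =
      sandwichTrace (opPow A n) X * sandwichTrace (opPow A m) Y := by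
  have hn := opPow_nonneg hA n
  have hm := opPow_nonneg hA m
  rw [sandwichTrace_eq_hsNormSq (opPow_nonneg hA _), sandwichTrace_eq_hsNormSq hn,
    sandwichTrace_eq_hsNormSq hm, opPow_add, sqrt_powTensor hn hm, sqrt_powTensor hX hY,
    powTensor_mul, hsNormSq_powTensor]

theorem norm_powTensor_le (S : HilbertPow H n →L[ℂ] HilbertPow H n)
    (T : HilbertPow H m →L[ℂ] HilbertPow H m) : ‖powTensor S T‖ ≤ ‖S‖ * ‖T‖ := by
  refine opNorm_le_bound _ (by positivity) fun x => ?_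
  change ‖append H n m (opTensor S T ((append H n m).symm x))‖ ≤ _
  rw [LinearIsometryEquiv.norm_map]
  refine (le_opNorm _ _).trans ?_
  rw [LinearIsometryEquiv.norm_map]
  gcongr
  exact (norm_completion_le _).trans (TensorProduct.norm_mapL_le S T)

theorem powTensor_le_one {X : HilbertPow H n →L[ℂ] HilbertPow H n}
    {Y : HilbertPow H m →L[ℂ] HilbertPow H m}
    (hX : 0 ≤ X) (hX1 : X ≤ 1) (hY : 0 ≤ Y) (hY1 : Y ≤ 1) : powTensor X Y ≤ 1 := by
  rw [← CStarAlgebra.norm_le_one_iff_of_nonneg _ hX] at hX1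
  rw [← CStarAlgebra.norm_le_one_iff_of_nonneg _ hY] at hY1
  rw [← CStarAlgebra.norm_le_one_iff_of_nonneg _ (powTensor_nonneg hX hY)]
  exact (norm_powTensor_le X Y).trans (mul_le_one₀ hX1 (norm_nonneg _) hY1)

end Append

section TracePow

variable {H : Type u} [NormedAddCommGroup H] [InnerProductSpace ℂ H] [CompleteSpace H]

variable (H) in
/-- The identification of `H` with its first tensor power, which is the completion of `ℂ ⊗ H` in
the recursive encoding. -/
noncomputable def powOne : H ≃ₗᵢ[ℂ] HilbertPow H 1 :=
  let e : H ≃ₗᵢ[ℂ] AlgPow H 1 := ((TensorProduct.lidIsometry ℂ H).symm.trans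
    (TensorProduct.congrIsometry (algZero H).symm (.refl ℂ H))).trans (algSucc H 0).symm
  let f : H →ₗᵢ[ℂ] HilbertPow H 1 := Completion.toComplₗᵢ.comp e.toLinearIsometry
  LinearIsometryEquiv.ofSurjective f <| Set.range_eq_univ.1 <| by
    rw [← f.isometry.isClosedEmbedding.isClosed_range.closure_eq]
    exact (Completion.denseRange_coe.comp e.surjective.denseRange
      (Completion.continuous_coe _)).closure_range

theorem opPow_one_powOne (A : H →L[ℂ] H) (x : H) : opPow A 1 (powOne H x) = powOne H (A x) := by
  change opPow A 1 (((algSucc H 0).symm ((algZero H).symm 1 ⊗ₜ x) : AlgPow H 1) :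
    HilbertPow H 1) = _
  rw [opPow, completion_apply_coe, algOpPow_succ_apply, TensorProduct.mapL_tmul]
  rfl

theorem hsNormSq_opPow_one (A : H →L[ℂ] H) : hsNormSq (opPow A 1) = hsNormSq A := by
  rw [hsNormSq_eq_tsum (HilbertBasis.ofRepr ((powOne H).symm.trans (stdBasis H).repr)), hsNormSq]
  refine tsum_congr fun i => ?_
  have hi : HilbertBasis.ofRepr ((powOne H).symm.trans (stdBasis H).repr) i =
      powOne H (stdBasis H i) := rfl
  rw [hi, opPow_one_powOne, LinearIsometryEquiv.enorm_map]

theorem psdTrace_opPow_one {A : H →L[ℂ] H} (hA : 0 ≤ A) : psdTrace (opPow A 1) = psdTrace A := by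
  have hs : opPow A 1 = star (opPow (CFC.sqrt A) 1) * opPow (CFC.sqrt A) 1 := by
    rw [← opPow_star, (isSelfAdjoint_sqrt A).star_eq, ← opPow_mul, CFC.sqrt_mul_sqrt_self A]
  rw [hs, psdTrace_star_mul_self, hsNormSq_opPow_one, psdTrace_eq_hsNormSq_sqrt hA]

theorem psdTrace_opPow {A : H →L[ℂ] H} (hA : 0 ≤ A) {n : ℕ} (hn : 1 ≤ n) :
    psdTrace (opPow A n) = psdTrace A ^ n := by
  have htr (n) : psdTrace (opPow A n) = sandwichTrace (opPow A n) 1 := by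
    rw [sandwichTrace_comm (opPow_nonneg hA n) zero_le_one,
      sandwichTrace_one_left (opPow_nonneg hA n)]
  induction n, hn using Nat.le_induction with
  | base => rw [psdTrace_opPow_one hA, pow_one]
  | succ n _ ih =>
    rw [htr, ← powTensor_one, sandwichTrace_powTensor hA zero_le_one zero_le_one, ← htr, ← htr, ih,
      psdTrace_opPow_one hA, pow_succ]

theorem opPow_mem_densityOperators {ρ : H →L[ℂ] H} (hρ : ρ ∈ densityOperators H) {n : ℕ}
    (hn : 1 ≤ n) : opPow ρ n ∈ densityOperators (HilbertPow H n) :=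
  ⟨opPow_nonneg hρ.1 n, by rw [psdTrace_opPow hρ.1 hn, hρ.2, one_pow]⟩

end TracePow

section Minimax

variable {Y : Type*} [TopologicalSpace Y]

theorem convex_setOf_forall_neg : Convex ℝ {f : C(Y, ℝ) | ∀ y, f y < 0} :=
  fun _ hf _ hg _ _ ha hb hab y => convex_Iio (0 : ℝ) (hf y) (hg y) ha hb hab

variable [CompactSpace Y]

theorem integrable_of_continuous [MeasurableSpace Y] [BorelSpace Y] {E : Type*}
    [NormedAddCommGroup E] (ν : Measure Y) [IsFiniteMeasure ν] {f : Y → E} (hf : Continuous f) :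
    Integrable f ν := by
  have hs : StronglyMeasurable f := by
    borelize E
    exact stronglyMeasurable_iff_measurable_separable.2
      ⟨hf.measurable, (isCompact_range hf).isSeparable⟩
  obtain ⟨C, hC⟩ := (isCompact_range hf).isBounded.exists_norm_le
  exact Integrable.of_bound hs.aestronglyMeasurable C
    (Eventually.of_forall fun y => hC _ ⟨y, rfl⟩)

theorem exists_probabilityMeasure_integral_eq [T2Space Y] [MeasurableSpace Y] [BorelSpace Y]
    (φ : C(Y, ℝ) →ₗ[ℝ] ℝ) (hφ : ∀ f, 0 ≤ f → 0 ≤ φ f) (hφ1 : φ 1 = 1) :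
    ∃ ν : Measure Y, IsProbabilityMeasure ν ∧ ∀ f : C(Y, ℝ), ∫ y, f y ∂ν = φ f := by
  let ψ : CompactlySupportedContinuousMap Y ℝ →ₗ[ℝ] ℝ :=
    { toFun := fun f => φ f.toContinuousMap
      map_add' := fun f g => map_add φ f.toContinuousMap g.toContinuousMap
      map_smul' := fun c f => map_smul φ c f.toContinuousMap }
  let Λ := PositiveLinearMap.mk₀ ψ fun f hf =>
    hφ f.toContinuousMap (CompactlySupportedContinuousMap.le_def.1 hf)
  have hint (f : C(Y, ℝ)) : ∫ y, f y ∂(RealRMK.rieszMeasure Λ) = φ f :=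
    RealRMK.integral_rieszMeasure Λ (CompactlySupportedContinuousMap.continuousMapEquiv f)
  refine ⟨RealRMK.rieszMeasure Λ, ⟨?_⟩, hint⟩
  have h1 := hint 1
  simp only [ContinuousMap.one_apply, integral_const, smul_eq_mul, mul_one, hφ1] at h1
  rwa [measureReal_def, ENNReal.toReal_eq_one_iff] at h1

theorem isOpen_setOf_forall_neg : IsOpen {f : C(Y, ℝ) | ∀ y, f y < 0} := by
  simpa [Set.MapsTo] using ContinuousMap.isOpen_setOfPred_mapsTo (X := Y) (Y := ℝ) isCompact_univ
    (isOpen_Iio (a := (0 : ℝ)))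

theorem exists_positive_functional_of_convex {𝒢 : Set C(Y, ℝ)} (hconv : Convex ℝ 𝒢)
    (hne : 𝒢.Nonempty) (h𝒢 : ∀ g ∈ 𝒢, ∃ y, 0 ≤ g y) :
    ∃ φ : C(Y, ℝ) →ₗ[ℝ] ℝ, (∀ f, 0 ≤ f → 0 ≤ φ f) ∧ φ 1 = 1 ∧ ∀ g ∈ 𝒢, 0 ≤ φ g := by
  have hdisj : Disjoint {f : C(Y, ℝ) | ∀ y, f y < 0} 𝒢 :=
    Set.disjoint_left.2 fun g hneg hg => (h𝒢 g hg).elim fun y hy => (hneg y).not_ge hy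
  obtain ⟨φ, u, hφneg, hφ𝒢⟩ :=
    geometric_hahn_banach_open convex_setOf_forall_neg isOpen_setOf_forall_neg hconv hdisj
  have hlt (f : C(Y, ℝ)) (hf : 0 ≤ f) (c : ℝ) (hc : 0 < c) : -φ f - c * φ 1 < u := by
    have := hφneg (-f - c • 1) fun y => by
      have hy : 0 ≤ f y := hf y
      simp only [ContinuousMap.sub_apply, ContinuousMap.neg_apply, ContinuousMap.smul_apply,
        ContinuousMap.one_apply, smul_eq_mul]
      linarith
    simpa using this
  have hpos (f : C(Y, ℝ)) (hf : 0 ≤ f) : 0 ≤ φ f := by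
    by_contra! hneg
    have h1 := hlt ((|u + φ 1| / -φ f) • f)
      (smul_nonneg (div_nonneg (abs_nonneg _) (by linarith)) hf) 1 one_pos
    rw [map_smul, smul_eq_mul, div_neg, neg_mul, div_mul_cancel₀ _ hneg.ne] at h1
    linarith [le_abs_self (u + φ 1)]
  have hφ1 : 0 < φ 1 := by
    obtain ⟨g, hg⟩ := hne
    have hg1 : φ g ≤ ‖g‖ * φ 1 := by
      have := hpos (‖g‖ • 1 - g) fun y => by
        simpa using (le_abs_self _).trans (g.norm_coe_le_norm y)
      simpa using this
    have hu := hlt 0 le_rfl 1 one_pos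
    rw [map_zero] at hu
    by_contra! h
    linarith [hφ𝒢 g hg, mul_nonpos_of_nonneg_of_nonpos (norm_nonneg g) h]
  have hu : 0 ≤ u := by
    by_contra! hu
    have := hlt 0 le_rfl (-u / φ 1) (div_pos (by linarith) hφ1)
    rw [map_zero, div_mul_cancel₀ _ hφ1.ne'] at this
    linarith
  exact ⟨(φ 1)⁻¹ • φ.toLinearMap, fun f hf => mul_nonneg (inv_nonneg.2 hφ1.le) (hpos f hf),
    inv_mul_cancel₀ hφ1.ne', fun g hg => mul_nonneg (inv_nonneg.2 hφ1.le) (hu.trans (hφ𝒢 g hg))⟩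

theorem exists_probabilityMeasure_integral_nonneg_of_convex [T2Space Y] [Nonempty Y]
    [MeasurableSpace Y] [BorelSpace Y] {𝒢 : Set C(Y, ℝ)} (hconv : Convex ℝ 𝒢)
    (h𝒢 : ∀ g ∈ 𝒢, ∃ y, 0 ≤ g y) :
    ∃ ν : Measure Y, IsProbabilityMeasure ν ∧ ∀ g ∈ 𝒢, 0 ≤ ∫ y, g y ∂ν := by
  rcases 𝒢.eq_empty_or_nonempty with rfl | hne
  · exact ⟨.dirac (Classical.arbitrary Y), inferInstance, by simp⟩
  obtain ⟨φ, hpos, hone, hφ𝒢⟩ := exists_positive_functional_of_convex hconv hne h𝒢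
  obtain ⟨ν, hν, hint⟩ := exists_probabilityMeasure_integral_eq φ hpos hone
  exact ⟨ν, hν, fun g hg => (hφ𝒢 g hg).trans_eq (hint g).symm⟩

/-- Rounding the coefficients of a large multiple `N • g` of a convex combination to integers
changes it by an amount that does not depend on `N`. -/
theorem exists_norm_smul_sub_le_of_mem_convexHull {E : Type*} [NormedAddCommGroup E]
    [NormedSpace ℝ E] {𝒢 : Set E} (hadd : ∀ f ∈ 𝒢, ∀ g ∈ 𝒢, f + g ∈ 𝒢) {g : E}
    (hg : g ∈ convexHull ℝ 𝒢) :
    ∃ K : ℝ, ∀ N : ℝ, 0 ≤ N → ∃ m ∈ 𝒢, ‖N • g - m‖ ≤ K := by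
  have hnsmul (f : E) (hf : f ∈ 𝒢) (k : ℕ) : (k + 1) • f ∈ 𝒢 := by
    induction k with
    | zero => simpa using hf
    | succ k ih => simpa only [succ_nsmul] using hadd _ ih _ hf
  have hsub : 𝒢 ⊆ {g | ∃ K : ℝ, ∀ N : ℝ, 0 ≤ N → ∃ m ∈ 𝒢, ‖N • g - m‖ ≤ K} := by
    refine fun g hg => ⟨‖g‖, fun N hN => ⟨(⌊N⌋₊ + 1) • g, hnsmul g hg _, ?_⟩⟩
    rw [← Nat.cast_smul_eq_nsmul ℝ, ← sub_smul, norm_smul]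
    refine mul_le_of_le_one_left (norm_nonneg _) ?_
    rw [Real.norm_eq_abs, abs_le]
    push_cast
    constructor <;> linarith [Nat.floor_le hN, Nat.lt_floor_add_one N]
  refine convexHull_min hsub ?_ hg
  rintro g₁ ⟨K₁, h₁⟩ g₂ ⟨K₂, h₂⟩ a b ha hb -
  refine ⟨K₁ + K₂, fun N hN => ?_⟩
  obtain ⟨m₁, hm₁, hn₁⟩ := h₁ (N * a) (by positivity)
  obtain ⟨m₂, hm₂, hn₂⟩ := h₂ (N * b) (by positivity)
  refine ⟨m₁ + m₂, hadd _ hm₁ _ hm₂, ?_⟩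
  rw [smul_add, smul_smul, smul_smul, add_sub_add_comm]
  exact (norm_add_le _ _).trans (add_le_add hn₁ hn₂)

theorem exists_nonneg_of_mem_convexHull [Nonempty Y] {𝒢 : Set C(Y, ℝ)}
    (hadd : ∀ f ∈ 𝒢, ∀ g ∈ 𝒢, f + g ∈ 𝒢) (h𝒢 : ∀ g ∈ 𝒢, ∃ y, 0 ≤ g y) {g : C(Y, ℝ)}
    (hg : g ∈ convexHull ℝ 𝒢) : ∃ y, 0 ≤ g y := by
  by_contra! hneg
  obtain ⟨y₀, -, hmax⟩ := isCompact_univ.exists_isMaxOn Set.univ_nonempty g.continuous.continuousOn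
  obtain ⟨K, hK⟩ := exists_norm_smul_sub_le_of_mem_convexHull hadd hg
  have hK0 : 0 ≤ K := by
    obtain ⟨m, -, h⟩ := hK 0 le_rfl
    exact (norm_nonneg _).trans h
  obtain ⟨N, hN, hNg⟩ : ∃ N : ℝ, 0 ≤ N ∧ N * g y₀ = -(K + 1) :=
    ⟨(K + 1) / -g y₀, div_nonneg (by linarith) (by linarith [hneg y₀]), by
      rw [div_neg, neg_mul, div_mul_cancel₀ _ (hneg y₀).ne]⟩
  obtain ⟨m, hm, hmn⟩ := hK N hN
  obtain ⟨y, hy⟩ := h𝒢 m hm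
  have hclose := (abs_le.1 ((ContinuousMap.norm_coe_le_norm (N • g - m) y).trans hmn)).1
  simp only [ContinuousMap.sub_apply, ContinuousMap.smul_apply, smul_eq_mul] at hclose
  linarith [mul_le_mul_of_nonneg_left (hmax (Set.mem_univ y) : g y ≤ g y₀) hN]

theorem exists_probabilityMeasure_integral_nonneg_of_add_mem [T2Space Y] [Nonempty Y]
    [MeasurableSpace Y] [BorelSpace Y] {𝒢 : Set C(Y, ℝ)}
    (hadd : ∀ f ∈ 𝒢, ∀ g ∈ 𝒢, f + g ∈ 𝒢) (h𝒢 : ∀ g ∈ 𝒢, ∃ y, 0 ≤ g y) :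
    ∃ ν : Measure Y, IsProbabilityMeasure ν ∧ ∀ g ∈ 𝒢, 0 ≤ ∫ y, g y ∂ν := by
  obtain ⟨ν, hν, hint⟩ := exists_probabilityMeasure_integral_nonneg_of_convex
    (convex_convexHull ℝ 𝒢) fun g hg => exists_nonneg_of_mem_convexHull hadd h𝒢 hg
  exact ⟨ν, hν, fun g hg => hint g (subset_convexHull ℝ 𝒢 hg)⟩

end Minimax

section GeometricMean

theorem toENNReal_log_le_self (x : ℝ≥0∞) : (ENNReal.log x).toENNReal ≤ x := by
  induction x with
  | top => exact le_top
  | coe x =>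
    rcases eq_or_ne x 0 with rfl | hx
    · simp
    have hx' : (0 : ℝ) < x := by positivity
    rw [← ENNReal.ofReal_coe_nnreal, ENNReal.log_ofReal_of_pos hx',
      EReal.toENNReal_of_ne_top (EReal.coe_ne_top _), EReal.toReal_coe]
    exact ENNReal.ofReal_le_ofReal (Real.log_le_self hx'.le)

variable {Y : Type*} [MeasurableSpace Y]

theorem geomMean_mono (ν : Measure Y) {f g : Y → ℝ≥0∞} (hfg : f ≤ g) :
    geomMean ν f ≤ geomMean ν g := by
  have hlog (y) : ENNReal.log (f y) ≤ ENNReal.log (g y) := ENNReal.log_monotone (hfg y)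
  refine EReal.exp_monotone (EReal.sub_le_sub (EReal.coe_ennreal_le_coe_ennreal_iff.2 ?_)
    (EReal.coe_ennreal_le_coe_ennreal_iff.2 ?_))
  · exact lintegral_mono fun y => EReal.toENNReal_le_toENNReal (hlog y)
  · exact lintegral_mono fun y => EReal.toENNReal_le_toENNReal (EReal.neg_le_neg_iff.2 (hlog y))

theorem geomMean_ofReal_eq (ν : Measure Y) {a : Y → ℝ} (ha : ∀ y, 0 < a y)
    (hint : Integrable (fun y => Real.log (a y)) ν) :
    geomMean ν (fun y => ENNReal.ofReal (a y)) =
      ENNReal.ofReal (Real.exp (∫ y, Real.log (a y) ∂ν)) := by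
  have hpos (y) : (ENNReal.log (ENNReal.ofReal (a y))).toENNReal =
      ENNReal.ofReal (Real.log (a y)) := by
    rw [ENNReal.log_ofReal_of_pos (ha y), EReal.toENNReal_of_ne_top (EReal.coe_ne_top _),
      EReal.toReal_coe]
  have hneg (y) : (-ENNReal.log (ENNReal.ofReal (a y))).toENNReal =
      ENNReal.ofReal (-Real.log (a y)) := by
    rw [ENNReal.log_ofReal_of_pos (ha y), ← EReal.coe_neg,
      EReal.toENNReal_of_ne_top (EReal.coe_ne_top _), EReal.toReal_coe]
  rw [geomMean, extIntegral, integral_eq_lintegral_pos_part_sub_lintegral_neg_part hint,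
    ← EReal.exp_coe]
  simp only [hpos, hneg]
  rw [EReal.coe_sub, EReal.coe_ennreal_toReal, EReal.coe_ennreal_toReal]
  · exact hint.neg.lintegral_lt_top.ne
  · exact hint.lintegral_lt_top.ne

theorem tendsto_geomMean_of_antitone (ν : Measure Y) {f : ℕ → Y → ℝ≥0∞} {g : Y → ℝ≥0∞}
    (hf : ∀ n, Measurable (f n)) (hanti : Antitone f) (hfin : ∫⁻ y, f 0 y ∂ν ≠ ∞)
    (hlim : ∀ y, Tendsto (fun n => f n y) atTop (𝓝 (g y))) :
    Tendsto (fun n => geomMean ν (f n)) atTop (𝓝 (geomMean ν g)) := by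
  have hlog (y) : Tendsto (fun n => ENNReal.log (f n y)) atTop (𝓝 (ENNReal.log (g y))) :=
    (ENNReal.continuous_log.tendsto _).comp (hlim y)
  have hm (n) : Measurable fun y => ENNReal.log (f n y) := ENNReal.measurable_log.comp (hf n)
  have hle (n y) : (ENNReal.log (f n y)).toENNReal ≤ f 0 y :=
    (toENNReal_log_le_self _).trans (hanti n.zero_le y)
  have hpos := tendsto_lintegral_of_dominated_convergence (f 0)
    (fun n => (hm n).ereal_toENNReal) (fun n => ae_of_all ν (hle n)) hfin
    (ae_of_all ν fun y => (EReal.continuous_toENNReal.tendsto _).comp (hlog y))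
  have hneg := lintegral_tendsto_of_tendsto_of_monotone (μ := ν)
    (fun n => (hm n).neg.ereal_toENNReal.aemeasurable)
    (ae_of_all ν fun y i j hij => EReal.toENNReal_le_toENNReal
      (EReal.neg_le_neg_iff.2 (ENNReal.log_monotone (hanti hij y))))
    (ae_of_all ν fun y => (EReal.continuous_toENNReal.tendsto _).comp (hlog y).neg)
  have hfinite : ∫⁻ y, (ENNReal.log (g y)).toENNReal ∂ν ≠ ∞ :=
    ne_top_of_le_ne_top hfin (lintegral_mono fun y => (toENNReal_log_le_self _).trans
      (le_of_tendsto' (hlim y) fun n => hanti n.zero_le y))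
  have hsub := (EReal.continuousAt_add (p := (_, _))
    (.inl (EReal.coe_ennreal_eq_top_iff.not.2 hfinite))
    (.inl (EReal.coe_ennreal_ne_bot _))).tendsto.comp
    (((continuous_coe_ennreal_ereal.tendsto _).comp hpos).prodMk_nhds
      ((continuous_coe_ennreal_ereal.tendsto _).comp hneg).neg)
  exact (ENNReal.continuous_exp.tendsto _).comp hsub

theorem integrable_log_add (ν : Measure Y) [IsFiniteMeasure ν] {a : Y → ℝ} (ha : ∀ y, 0 ≤ a y)
    (hint : Integrable a ν) {ε : ℝ} (hε : 0 < ε) : Integrable (fun y => Real.log (a y + ε)) ν := by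
  have hmeas := (hint.aestronglyMeasurable.aemeasurable.add_const ε).log.aestronglyMeasurable
  refine ((hint.add (integrable_const ε)).add (integrable_const |Real.log ε|)).mono' hmeas
    (ae_of_all ν fun y => ?_)
  have hlower : Real.log ε ≤ Real.log (a y + ε) := Real.log_le_log hε (by linarith [ha y])
  have hupper : Real.log (a y + ε) ≤ a y + ε := Real.log_le_self (by linarith [ha y])
  rw [Real.norm_eq_abs, abs_le]
  simp only [Pi.add_apply]
  constructor <;> linarith [neg_abs_le (Real.log ε), abs_nonneg (Real.log ε), ha y]

theorem geomMean_ofReal_le (ν : Measure Y) [IsProbabilityMeasure ν] {a : Y → ℝ}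
    (ha : ∀ y, 0 ≤ a y) (hint : Integrable a ν) :
    geomMean ν (fun y => ENNReal.ofReal (a y)) ≤ ENNReal.ofReal (∫ y, a y ∂ν) := by
  have hle (ε : ℝ) (hε : 0 < ε) :
      geomMean ν (fun y => ENNReal.ofReal (a y)) ≤ ENNReal.ofReal (∫ y, a y ∂ν + ε) := by
    have hpos (y) : 0 < a y + ε := by linarith [ha y]
    have hlog := integrable_log_add ν ha hint hε
    have hexp (y) : Real.exp (Real.log (a y + ε)) = a y + ε := Real.exp_log (hpos y)
    have hjensen := convexOn_exp.map_integral_le Real.continuous_exp.continuousOn isClosed_univ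
      (ae_of_all ν fun _ => Set.mem_univ _) hlog
      (by simp only [Function.comp_def, hexp]; exact hint.add (integrable_const ε))
    simp only [hexp, integral_add hint (integrable_const ε), integral_const, probReal_univ,
      one_smul] at hjensen
    calc geomMean ν (fun y => ENNReal.ofReal (a y))
        ≤ geomMean ν fun y => ENNReal.ofReal (a y + ε) :=
          geomMean_mono ν fun y => ENNReal.ofReal_le_ofReal (by linarith)
      _ = ENNReal.ofReal (Real.exp (∫ y, Real.log (a y + ε) ∂ν)) := geomMean_ofReal_eq ν hpos hlog
      _ ≤ ENNReal.ofReal (∫ y, a y ∂ν + ε) := ENNReal.ofReal_le_ofReal hjensen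
  have hlim : Tendsto (fun ε : ℝ => ENNReal.ofReal (∫ y, a y ∂ν + ε)) (𝓝[>] 0)
      (𝓝 (ENNReal.ofReal (∫ y, a y ∂ν + 0))) :=
    ((ENNReal.continuous_ofReal.comp (continuous_const.add continuous_id)).tendsto 0).mono_left
      nhdsWithin_le_nhds
  rw [add_zero] at hlim
  exact ge_of_tendsto hlim (eventually_mem_nhdsWithin.mono hle)

theorem geomMean_congr_ae {ν : Measure Y} {f g : Y → ℝ≥0∞} (hfg : f =ᵐ[ν] g) :
    geomMean ν f = geomMean ν g := by
  have hpos : ∫⁻ y, (ENNReal.log (f y)).toENNReal ∂ν = ∫⁻ y, (ENNReal.log (g y)).toENNReal ∂ν :=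
    lintegral_congr_ae (hfg.mono fun y hy => by simp only [hy])
  have hneg : ∫⁻ y, (-ENNReal.log (f y)).toENNReal ∂ν = ∫⁻ y, (-ENNReal.log (g y)).toENNReal ∂ν :=
    lintegral_congr_ae (hfg.mono fun y hy => by simp only [hy])
  rw [geomMean, geomMean, extIntegral, extIntegral, hpos, hneg]

theorem geomMean_le_lintegral (ν : Measure Y) [IsProbabilityMeasure ν] {f : Y → ℝ≥0∞}
    (hf : AEMeasurable f ν) : geomMean ν f ≤ ∫⁻ y, f y ∂ν := by
  rcases eq_or_ne (∫⁻ y, f y ∂ν) ∞ with hfin | hfin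
  · exact hfin ▸ le_top
  have hae := (ae_lt_top' hf hfin).mono fun y hy => (ENNReal.ofReal_toReal hy.ne).symm
  rw [geomMean_congr_ae hae, lintegral_congr_ae hae,
    ← ofReal_integral_eq_lintegral_ofReal (integrable_toReal_of_lintegral_ne_top hf hfin)
      (ae_of_all ν fun y => ENNReal.toReal_nonneg)]
  exact geomMean_ofReal_le ν (fun y => ENNReal.toReal_nonneg)
    (integrable_toReal_of_lintegral_ne_top hf hfin)

theorem ofReal_le_geomMean (ν : Measure Y) [IsFiniteMeasure ν] {a : Y → ℝ}
    (ham : Measurable a) (ha : ∀ y, 0 ≤ a y) (hint : Integrable a ν) {c : ℝ} (hc : 0 < c)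
    (h : ∀ ε : ℝ, 0 < ε → Real.log c ≤ ∫ y, Real.log (a y + ε) ∂ν) :
    ENNReal.ofReal c ≤ geomMean ν fun y => ENNReal.ofReal (a y) := by
  have hε (n : ℕ) : (0 : ℝ) < 1 / ((n : ℝ) + 1) := by positivity
  have hlim (y) : Tendsto (fun n : ℕ => ENNReal.ofReal (a y + 1 / ((n : ℝ) + 1))) atTop
      (𝓝 (ENNReal.ofReal (a y))) := by
    simpa using ENNReal.tendsto_ofReal (tendsto_one_div_add_atTop_nhds_zero_nat.const_add (a y))
  refine ge_of_tendsto' (tendsto_geomMean_of_antitone ν (fun n => by fun_prop) ?_ ?_ hlim)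
    fun n => ?_
  · intro m n hmn y
    dsimp only
    gcongr
  · exact (hint.add (integrable_const _)).lintegral_lt_top.ne
  · have hpos (y) : 0 < a y + 1 / ((n : ℝ) + 1) := add_pos_of_nonneg_of_pos (ha y) (hε n)
    rw [geomMean_ofReal_eq ν hpos (integrable_log_add ν ha hint (hε n)), ← Real.exp_log hc]
    exact ENNReal.ofReal_le_ofReal (Real.exp_le_exp.2 (h _ (hε n)))

/-- Multiplicativity of `𝒬` makes the set of functions `g` with `p.1 ≤ p.2 * exp g` for some
`p ∈ 𝒬` closed under addition; it contains `log (p.1 + ε) - log p.2` for every `ε > 0`. -/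
theorem exists_forall_le_geomMean_of_mul_mem [TopologicalSpace Y] [CompactSpace Y] [T2Space Y]
    [Nonempty Y] [BorelSpace Y] {𝒬 : Set (C(Y, ℝ) × ℝ)} (hnonneg : ∀ p ∈ 𝒬, ∀ y, 0 ≤ p.1 y)
    (hmul : ∀ p ∈ 𝒬, ∀ q ∈ 𝒬, p * q ∈ 𝒬) (hle : ∀ p ∈ 𝒬, ∃ y, p.2 ≤ p.1 y) :
    ∃ ν : Measure Y, IsProbabilityMeasure ν ∧ ∀ p ∈ 𝒬,
      ENNReal.ofReal p.2 ≤ geomMean ν fun y => ENNReal.ofReal (p.1 y) := by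
  let 𝒢 : Set C(Y, ℝ) := {g | ∃ p ∈ 𝒬, 0 < p.2 ∧ ∀ y, p.1 y ≤ p.2 * Real.exp (g y)}
  have hadd : ∀ f ∈ 𝒢, ∀ g ∈ 𝒢, f + g ∈ 𝒢 := by
    rintro f ⟨p, hp, hp2, hf⟩ g ⟨q, hq, hq2, hg⟩
    refine ⟨p * q, hmul p hp q hq, mul_pos hp2 hq2, fun y => ?_⟩
    calc p.1 y * q.1 y ≤ (p.2 * Real.exp (f y)) * (q.2 * Real.exp (g y)) :=
          mul_le_mul (hf y) (hg y) (hnonneg q hq y) (by positivity)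
      _ = p.2 * q.2 * Real.exp (f y + g y) := by rw [Real.exp_add]; ring
  have h𝒢 : ∀ g ∈ 𝒢, ∃ y, 0 ≤ g y := by
    rintro g ⟨p, hp, hp2, hg⟩
    obtain ⟨y, hy⟩ := hle p hp
    have := hy.trans (hg y)
    rw [le_mul_iff_one_le_right hp2, Real.one_le_exp_iff] at this
    exact ⟨y, this⟩
  obtain ⟨ν, hν, hint⟩ := exists_probabilityMeasure_integral_nonneg_of_add_mem hadd h𝒢
  refine ⟨ν, hν, fun p hp => ?_⟩
  rcases le_or_gt p.2 0 with h0 | h0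
  · rw [ENNReal.ofReal_of_nonpos h0]
    exact zero_le
  refine ofReal_le_geomMean ν p.1.continuous.measurable (hnonneg p hp)
    (integrable_of_continuous ν p.1.continuous) h0 fun ε hε => ?_
  have hpos (y) : 0 < p.1 y + ε := add_pos_of_nonneg_of_pos (hnonneg p hp y) hε
  have hlog : Continuous fun y => Real.log (p.1 y + ε) :=
    Continuous.log (by fun_prop) fun y => (hpos y).ne'
  have hmem : (⟨fun y => Real.log (p.1 y + ε) - Real.log p.2, by fun_prop⟩ : C(Y, ℝ)) ∈ 𝒢 := by
    refine ⟨p, hp, h0, fun y => ?_⟩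
    change p.1 y ≤ p.2 * Real.exp (Real.log (p.1 y + ε) - Real.log p.2)
    rw [Real.exp_sub, Real.exp_log (hpos y), Real.exp_log h0,
      mul_div_cancel₀ _ h0.ne']
    linarith
  have hge := hint _ hmem
  simp only [ContinuousMap.coe_mk] at hge
  rw [integral_sub (integrable_of_continuous ν hlog) (integrable_const _)] at hge
  simpa using hge

end GeometricMean

section Continuity

variable {Y : Type*} [TopologicalSpace Y]

theorem le_ciSup_iff_exists_le [CompactSpace Y] [Nonempty Y] {β : Type*}
    [ConditionallyCompleteLinearOrder β] [TopologicalSpace β] [OrderTopology β] {f : Y → β}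
    (hf : Continuous f) {c : β} : c ≤ ⨆ y, f y ↔ ∃ y, c ≤ f y := by
  obtain ⟨y₀, -, hmax⟩ := isCompact_univ.exists_isMaxOn Set.univ_nonempty hf.continuousOn
  have hle (y) : f y ≤ f y₀ := hmax (Set.mem_univ y)
  exact ⟨fun h => ⟨y₀, h.trans (ciSup_le hle)⟩,
    fun ⟨y, hy⟩ => hy.trans (le_ciSup ⟨f y₀, Set.forall_mem_range.2 hle⟩ y)⟩

theorem continuous_of_lowerSemicontinuous_of_add_eq_const {f g : Y → ℝ≥0∞} {M : ℝ≥0∞}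
    (hM : M ≠ ∞) (hf : LowerSemicontinuous f) (hg : LowerSemicontinuous g)
    (hfg : ∀ y, f y + g y = M) : Continuous f := by
  have hg_ne (y) : g y ≠ ∞ := ne_top_of_le_ne_top hM (hfg y ▸ le_add_self)
  refine continuous_iff_lower_upperSemicontinuous.2
    ⟨hf, upperSemicontinuous_iff_isOpen_preimage.2 fun b => ?_⟩
  rcases lt_or_ge M b with hb | hb
  · convert isOpen_univ
    exact Set.eq_univ_of_forall fun y => (hfg y ▸ le_self_add : f y ≤ M).trans_lt hb
  · convert lowerSemicontinuous_iff_isOpen_preimage.1 hg (M - b) using 1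
    ext y
    rw [Set.mem_preimage, Set.mem_preimage, Set.mem_Iio, Set.mem_Ioi,
      ENNReal.sub_lt_iff_lt_left (ne_top_of_le_ne_top hM hb) hb, ← hfg y,
      ENNReal.add_lt_add_iff_right (hg_ne y)]

variable {K : Type*} [NormedAddCommGroup K] [InnerProductSpace ℂ K] [CompleteSpace K]

theorem le_norm_smul_one {A : K →L[ℂ] K} (hA : IsSelfAdjoint A) : A ≤ ‖A‖ • (1 : K →L[ℂ] K) := by
  rw [← Algebra.algebraMap_eq_smul_one]
  exact hA.le_algebraMap_norm_self

theorem sandwichTrace_le_add_norm_sub {A B X : K →L[ℂ] K} (hA : IsSelfAdjoint A) (hB : 0 ≤ B)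
    (hX : 0 ≤ X) :
    sandwichTrace A X ≤ sandwichTrace B X + ENNReal.ofReal ‖A - B‖ * psdTrace X := by
  have hle : A ≤ B + ‖A - B‖ • (1 : K →L[ℂ] K) :=
    sub_le_iff_le_add'.1 (le_norm_smul_one (hA.sub (.of_nonneg hB)))
  refine (sandwichTrace_mono_left hle X).trans_eq ?_
  rw [sandwichTrace_add_left hB (smul_nonneg (norm_nonneg _) zero_le_one),
    sandwichTrace_smul_left (norm_nonneg _), sandwichTrace_one_left hX]

theorem continuous_sandwichTrace {F : Y → K →L[ℂ] K} (hF : Continuous F) (hF0 : ∀ y, 0 ≤ F y)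
    {X : K →L[ℂ] K} (hX : 0 ≤ X) (hX' : psdTrace X ≠ ∞) :
    Continuous fun y => sandwichTrace (F y) X := by
  refine continuous_iff_continuousAt.2 fun y₀ => tendsto_order.2
    ⟨fun c hc => hF.continuousAt.eventually (lowerSemicontinuous_sandwichTrace X _ c hc),
      fun c hc => ?_⟩
  have hnorm : Tendsto (fun y => ENNReal.ofReal ‖F y - F y₀‖) (𝓝 y₀) (𝓝 0) := by
    have hcont : Continuous fun y => ENNReal.ofReal ‖F y - F y₀‖ :=
      ENNReal.continuous_ofReal.comp (by fun_prop)
    simpa using hcont.tendsto y₀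
  have hlim : Tendsto (fun y => sandwichTrace (F y₀) X + ENNReal.ofReal ‖F y - F y₀‖ * psdTrace X)
      (𝓝 y₀) (𝓝 (sandwichTrace (F y₀) X)) := by
    simpa using (ENNReal.Tendsto.mul_const hnorm (.inr hX')).const_add (sandwichTrace (F y₀) X)
  filter_upwards [hlim.eventually_lt_const hc] with y hy
  exact (sandwichTrace_le_add_norm_sub (.of_nonneg (hF0 y)) (hF0 y₀) hX).trans_lt hy

theorem psdTrace_ne_top_of_mem_densityOperators {ρ : K →L[ℂ] K} (hρ : ρ ∈ densityOperators K) :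
    psdTrace ρ ≠ ∞ := hρ.2.trans_ne ENNReal.one_ne_top

/-- `Tr ρ X` and `Tr ρ (‖X‖ - X)` are both lower semicontinuous in `ρ`, and their sum is
constant on density operators. -/
theorem continuous_sandwichTrace_of_mem_densityOperators {F : Y → K →L[ℂ] K} (hF : Continuous F)
    (hF1 : ∀ y, F y ∈ densityOperators K) {X : K →L[ℂ] K} (hX : 0 ≤ X) :
    Continuous fun y => sandwichTrace (F y) X := by
  have hlsc (Z : K →L[ℂ] K) : LowerSemicontinuous fun y => sandwichTrace (F y) Z :=
    (lowerSemicontinuous_sandwichTrace Z).comp hF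
  refine continuous_of_lowerSemicontinuous_of_add_eq_const (M := ENNReal.ofReal ‖X‖)
    ENNReal.ofReal_ne_top (hlsc X) (hlsc (‖X‖ • 1 - X)) fun y => ?_
  rw [← sandwichTrace_add_right (hF1 y).1 hX (sub_nonneg.2 (le_norm_smul_one (.of_nonneg hX))),
    add_sub_cancel, sandwichTrace_smul_right (norm_nonneg _) (hF1 y).1 zero_le_one,
    sandwichTrace_comm (hF1 y).1 zero_le_one, sandwichTrace_one_left (hF1 y).1, (hF1 y).2, mul_one]

end Continuity

section Averages

variable {K : Type*} [NormedAddCommGroup K] [InnerProductSpace ℂ K]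
variable {Y : Type*} [MeasurableSpace Y] {ν : Measure Y} {F : Y → K →L[ℂ] K}

theorem integrable_re_inner (hF : Integrable F ν) (x : K) :
    Integrable (fun y => (⟪x, F y x⟫_ℂ).re) ν :=
  ((hF.apply_continuousLinearMap x).const_inner (𝕜 := ℂ) x).re

theorem aemeasurable_ofReal_re_inner (hF : Integrable F ν) (x : K) :
    AEMeasurable (fun y => ENNReal.ofReal (⟪x, F y x⟫_ℂ).re) ν :=
  (integrable_re_inner hF x).aestronglyMeasurable.aemeasurable.ennreal_ofReal

variable [CompleteSpace K]

theorem re_inner_integral (hF : Integrable F ν) (x : K) :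
    (⟪x, (∫ y, F y ∂ν) x⟫_ℂ).re = ∫ y, (⟪x, F y x⟫_ℂ).re ∂ν := by
  have hFx := hF.apply_continuousLinearMap x
  rw [integral_apply hF, ← integral_inner (𝕜 := ℂ) hFx]
  exact (integral_re (𝕜 := ℂ) (hFx.const_inner x)).symm

theorem ofReal_re_inner_integral (hF : Integrable F ν) (hF0 : ∀ y, 0 ≤ F y) (x : K) :
    ENNReal.ofReal (⟪x, (∫ y, F y ∂ν) x⟫_ℂ).re = ∫⁻ y, ENNReal.ofReal (⟪x, F y x⟫_ℂ).re ∂ν := by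
  rw [re_inner_integral hF, ofReal_integral_eq_lintegral_ofReal (integrable_re_inner hF x)
    (ae_of_all ν fun y => re_inner_nonneg (hF0 y) x)]

theorem sandwichTrace_eq_tsum (A X : K →L[ℂ] K) : sandwichTrace A X =
    ∑' i, ENNReal.ofReal
      (⟪CFC.sqrt X (stdBasis K i), A (CFC.sqrt X (stdBasis K i))⟫_ℂ).re := by
  refine tsum_congr fun i => ?_
  rw [mul_apply_eq_comp, mul_apply_eq_comp, ← adjoint_inner_left, ← star_eq_adjoint,
    (isSelfAdjoint_sqrt X).star_eq]

/-- An operator of finite trace annihilates all but countably many basis vectors, so that Tonelli's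
theorem applies on nonseparable spaces as well. -/
theorem sandwichTrace_integral (hF : Integrable F ν) (hF0 : ∀ y, 0 ≤ F y) {X : K →L[ℂ] K}
    (hX : 0 ≤ X) (hX' : psdTrace X ≠ ∞) :
    sandwichTrace (∫ y, F y ∂ν) X = ∫⁻ y, sandwichTrace (F y) X ∂ν := by
  rw [psdTrace_eq_hsNormSq_sqrt hX] at hX'
  let s : Set (basisIndex K) := Function.support fun i => ‖CFC.sqrt X (stdBasis K i)‖ₑ ^ 2
  have : Countable s := (Summable.countable_support_ennreal hX').to_subtype
  have hsupp (A : K →L[ℂ] K) : sandwichTrace A X = ∑' i : s, ENNReal.ofReal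
      (⟪CFC.sqrt X (stdBasis K i), A (CFC.sqrt X (stdBasis K i))⟫_ℂ).re := by
    refine (sandwichTrace_eq_tsum A X).trans (tsum_subtype_eq_of_support_subset
      (f := fun i => ENNReal.ofReal
        (⟪CFC.sqrt X (stdBasis K i), A (CFC.sqrt X (stdBasis K i))⟫_ℂ).re) fun i hi => ?_).symm
    contrapose! hi
    have hzero : CFC.sqrt X (stdBasis K i) = 0 := by simpa [s] using hi
    simp [hzero]
  simp only [hsupp]
  rw [lintegral_tsum fun i => aemeasurable_ofReal_re_inner hF _]
  exact tsum_congr fun i => ofReal_re_inner_integral hF hF0 _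

theorem sandwichTrace_integral_le_iSup [IsProbabilityMeasure ν] (hF : Integrable F ν)
    (hF0 : ∀ y, 0 ≤ F y) (X : K →L[ℂ] K) :
    sandwichTrace (∫ y, F y ∂ν) X ≤ ⨆ y, sandwichTrace (F y) X := by
  rw [sandwichTrace_eq_tsum, ENNReal.tsum_eq_iSup_sum]
  refine iSup_le fun s => ?_
  simp only [ofReal_re_inner_integral hF hF0]
  rw [← lintegral_finsetSum' s fun i _ => aemeasurable_ofReal_re_inner hF _]
  have hle (y) : ∑ i ∈ s, ENNReal.ofReal
      (⟪CFC.sqrt X (stdBasis K i), F y (CFC.sqrt X (stdBasis K i))⟫_ℂ).re ≤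
        ⨆ y, sandwichTrace (F y) X :=
    le_iSup_of_le y ((ENNReal.sum_le_tsum s).trans_eq (sandwichTrace_eq_tsum _ X).symm)
  exact (lintegral_mono hle).trans_eq (by simp)

theorem sandwichTrace_le_iSup_of_le_integral [IsProbabilityMeasure ν] (hF : Integrable F ν)
    (hF0 : ∀ y, 0 ≤ F y) {D : K →L[ℂ] K} (hD : D ≤ ∫ y, F y ∂ν) (X : K →L[ℂ] K) :
    sandwichTrace D X ≤ ⨆ y, sandwichTrace (F y) X :=
  (sandwichTrace_mono_left hD X).trans (sandwichTrace_integral_le_iSup hF hF0 X)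

theorem sandwichTrace_le_sandwichTrace_integral_of_le_geomMean [TopologicalSpace Y]
    [CompactSpace Y] [BorelSpace Y] [IsProbabilityMeasure ν] (hF : Continuous F)
    (hF0 : ∀ y, 0 ≤ F y) {D X : K →L[ℂ] K} (hX : 0 ≤ X) (hX' : psdTrace X ≠ ∞)
    (h : sandwichTrace D X ≤ geomMean ν fun y => sandwichTrace (F y) X) :
    sandwichTrace D X ≤ sandwichTrace (∫ y, F y ∂ν) X :=
  calc sandwichTrace D X ≤ geomMean ν fun y => sandwichTrace (F y) X := h
    _ ≤ ∫⁻ y, sandwichTrace (F y) X ∂ν :=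
      geomMean_le_lintegral ν (continuous_sandwichTrace hF hF0 hX hX').aemeasurable
    _ = sandwichTrace (∫ y, F y ∂ν) X :=
      (sandwichTrace_integral (integrable_of_continuous ν hF) hF0 hX hX').symm

end Averages

section Order

variable {K : Type*} [NormedAddCommGroup K] [InnerProductSpace ℂ K] [CompleteSpace K]

theorem AttainsInfSpec.smul_one_le {𝒮 : Set (K →L[ℂ] K)} (hinf : AttainsInfSpec 𝒮)
    (h𝒮 : 𝒮 ⊆ densityOperators K) {Z : K →L[ℂ] K} (hZ : 0 ≤ Z) {c : ℝ}
    (hc : ∀ ρ ∈ 𝒮, ENNReal.ofReal c ≤ sandwichTrace Z ρ) : c • (1 : K →L[ℂ] K) ≤ Z := by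
  rcases subsingleton_or_nontrivial K with hK | hK
  · exact (Subsingleton.elim _ _).le
  have hne : 𝒮.Nonempty := by
    rw [Set.nonempty_iff_ne_empty]
    rintro rfl
    simpa [spectrum.one_eq] using hinf 1 zero_le_one
  have hspec : c ≤ sInf (spectrum ℝ Z) := by
    rw [← hinf Z hZ]
    refine le_csInf (hne.image _) (Set.forall_mem_image.2 fun ρ hρ => ?_)
    obtain ⟨htr, htr0⟩ := sandwichTrace_eq_ofReal_re_tr hZ (h𝒮 hρ).1
      (psdTrace_ne_top_of_mem_densityOperators (h𝒮 hρ))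
    exact (ENNReal.ofReal_le_ofReal_iff htr0).1 ((hc ρ hρ).trans_eq htr)
  rw [← Algebra.algebraMap_eq_smul_one, algebraMap_le_iff_le_spectrum (.of_nonneg hZ)]
  exact fun x hx =>
    hspec.trans (csInf_le ⟨0, fun y hy => spectrum_nonneg_of_nonneg hZ hy⟩ hx)

theorem AttainsInfSpec.le_of_forall_sandwichTrace_le {𝒮 : Set (K →L[ℂ] K)}
    (hinf : AttainsInfSpec 𝒮) (h𝒮 : 𝒮 ⊆ densityOperators K) {D M : K →L[ℂ] K} (hD : 0 ≤ D)
    (hM : 0 ≤ M) (h : ∀ ρ ∈ 𝒮, sandwichTrace D ρ ≤ sandwichTrace M ρ) : D ≤ M := by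
  have hD' : 0 ≤ ‖D‖ • (1 : K →L[ℂ] K) - D := sub_nonneg.2 (le_norm_smul_one (.of_nonneg hD))
  have hle : ‖D‖ • (1 : K →L[ℂ] K) ≤ M + (‖D‖ • 1 - D) := by
    refine hinf.smul_one_le h𝒮 (add_nonneg hM hD') fun ρ hρ => ?_
    calc ENNReal.ofReal ‖D‖ = sandwichTrace (‖D‖ • 1) ρ := by
          rw [sandwichTrace_smul_left (norm_nonneg _), sandwichTrace_one_left (h𝒮 hρ).1,
            (h𝒮 hρ).2, mul_one]
      _ = sandwichTrace D ρ + sandwichTrace (‖D‖ • 1 - D) ρ := by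
          rw [← sandwichTrace_add_left hD hD', add_sub_cancel]
      _ ≤ sandwichTrace M ρ + sandwichTrace (‖D‖ • 1 - D) ρ := by gcongr; exact h ρ hρ
      _ = sandwichTrace (M + (‖D‖ • 1 - D)) ρ := (sandwichTrace_add_left hM hD' ρ).symm
  rw [← sub_nonneg] at hle ⊢
  convert hle using 1
  abel

theorem AttainsInfSpec.le_of_forall_sandwichTrace_conj_le {𝒮 : Set (K →L[ℂ] K)}
    (hinf : AttainsInfSpec 𝒮) (h𝒮 : 𝒮 ⊆ densityOperators K) {D M R : K →L[ℂ] K} (hD : 0 ≤ D)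
    (hM : 0 ≤ M) (hR : IsSelfAdjoint R) (hRu : IsUnit R)
    (h : ∀ ρ ∈ 𝒮, sandwichTrace D (R * ρ * R) ≤ sandwichTrace M (R * ρ * R)) : D ≤ M := by
  have hle : R * D * R ≤ R * M * R :=
    hinf.le_of_forall_sandwichTrace_le h𝒮 (hR.conjugate_nonneg hD) (hR.conjugate_nonneg hM)
      fun ρ hρ => by
        rw [← sandwichTrace_conj hD (h𝒮 hρ).1 hR, ← sandwichTrace_conj hM (h𝒮 hρ).1 hR]
        exact h ρ hρ
  rw [← sub_nonneg, ← hRu.star_left_conjugate_nonneg_iff, hR.star_eq, mul_sub, sub_mul]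
  exact sub_nonneg.2 hle

theorem psdTrace_conj_ne_top {X R : K →L[ℂ] K} (hX : 0 ≤ X) (hX' : psdTrace X ≠ ∞)
    (hR : IsSelfAdjoint R) : psdTrace (R * X * R) ≠ ∞ := by
  rw [← sandwichTrace_one_left (hR.conjugate_nonneg hX), sandwichTrace_conj zero_le_one hX hR]
  exact sandwichTrace_ne_top (hR.conjugate_nonneg zero_le_one) hX hX'

theorem exists_conj_mem_rescaled {D : K →L[ℂ] K} (hD : 0 ≤ D) (𝒮 : Set (K →L[ℂ] K)) {δ : ℝ}
    (hδ : 0 < δ) : ∃ R : K →L[ℂ] K, IsSelfAdjoint R ∧ IsUnit R ∧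
      ∀ ρ ∈ 𝒮, R * ρ * R ∈ rescaled D 𝒮 δ := by
  have hpos : IsStrictlyPositive (D + (δ / 2) • (1 : K →L[ℂ] K)) := by
    refine IsStrictlyPositive.nonneg_add hD ⟨smul_nonneg (half_pos hδ).le zero_le_one, ?_⟩
    rw [← Algebra.algebraMap_eq_smul_one]
    exact (isUnit_iff_ne_zero.2 (half_pos hδ).ne').map (algebraMap ℝ (K →L[ℂ] K))
  exact ⟨_, .of_nonneg CFC.rpow_nonneg, hpos.isUnit.cfcRpow (-(1 / 2)) hpos.nonneg,
    fun ρ hρ => ⟨ρ, hρ, δ / 2, ⟨half_pos hδ, half_lt_self hδ⟩, rfl⟩⟩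

end Order

section WeakBounds

variable {K : Type*} [NormedAddCommGroup K] [InnerProductSpace ℂ K] [CompleteSpace K]

theorem toReal_sandwichTrace_add_smul {A X X' : K →L[ℂ] K} (hA : 0 ≤ A) (hX : 0 ≤ X)
    (hX' : 0 ≤ X') (hXtr : psdTrace X ≠ ∞) (hXtr' : psdTrace X' ≠ ∞) {a b : ℝ} (ha : 0 ≤ a)
    (hb : 0 ≤ b) : (sandwichTrace A (a • X + b • X')).toReal =
      a * (sandwichTrace A X).toReal + b * (sandwichTrace A X').toReal := by
  rw [sandwichTrace_add_right hA (smul_nonneg ha hX) (smul_nonneg hb hX'),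
    sandwichTrace_smul_right ha hA hX, sandwichTrace_smul_right hb hA hX',
    ENNReal.toReal_add (ENNReal.mul_ne_top ENNReal.ofReal_ne_top (sandwichTrace_ne_top hA hX hXtr))
      (ENNReal.mul_ne_top ENNReal.ofReal_ne_top (sandwichTrace_ne_top hA hX' hXtr')),
    ENNReal.toReal_mul, ENNReal.toReal_mul, ENNReal.toReal_ofReal ha, ENNReal.toReal_ofReal hb]

variable {Y : Type*} [TopologicalSpace Y] {F : Y → K →L[ℂ] K}

theorem continuous_toReal_sandwichTrace (hF : Continuous F) (hF0 : ∀ y, 0 ≤ F y)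
    {X : K →L[ℂ] K} (hX : 0 ≤ X) (hXtr : psdTrace X ≠ ∞) :
    Continuous fun y => (sandwichTrace (F y) X).toReal :=
  ENNReal.continuousOn_toReal.comp_continuous (continuous_sandwichTrace hF hF0 hX hXtr)
    fun y => sandwichTrace_ne_top (hF0 y) hX hXtr

variable [CompactSpace Y] [MeasurableSpace Y] [BorelSpace Y] {D : K →L[ℂ] K}
  {𝒮 : Set (K →L[ℂ] K)} {δ : ℝ}

theorem integral_sub_toReal_sandwichTrace (ν : Measure Y) [IsProbabilityMeasure ν]
    (hF : Continuous F) (hF0 : ∀ y, 0 ≤ F y) {X : K →L[ℂ] K} (hX : 0 ≤ X) (hXtr : psdTrace X ≠ ∞)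
    (c : ℝ) : ∫ y, ((sandwichTrace (F y) X).toReal - c) ∂ν =
      (sandwichTrace (∫ y, F y ∂ν) X).toReal - c := by
  have hfin (y) : sandwichTrace (F y) X < ∞ := (sandwichTrace_ne_top (hF0 y) hX hXtr).lt_top
  have hint := integrable_of_continuous ν (continuous_toReal_sandwichTrace hF hF0 hX hXtr)
  rw [integral_sub hint (integrable_const c), integral_const, probReal_univ, one_smul,
    integral_toReal (continuous_sandwichTrace hF hF0 hX hXtr).aemeasurable (ae_of_all ν hfin),
    sandwichTrace_integral (integrable_of_continuous ν hF) hF0 hX hXtr]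

theorem exists_probabilityMeasure_forall_sandwichTrace_le_integral [T2Space Y] [Nonempty Y]
    (hF : Continuous F) (hF0 : ∀ y, 0 ≤ F y) (hD : 0 ≤ D) {𝒳 : Set (K →L[ℂ] K)}
    (hconv : Convex ℝ 𝒳) (h𝒳 : ∀ X ∈ 𝒳, 0 ≤ X) (h𝒳tr : ∀ X ∈ 𝒳, psdTrace X ≠ ∞)
    (hle : ∀ X ∈ 𝒳, sandwichTrace D X ≤ ⨆ y, sandwichTrace (F y) X) :
    ∃ μ : Measure Y, IsProbabilityMeasure μ ∧
      ∀ X ∈ 𝒳, sandwichTrace D X ≤ sandwichTrace (∫ y, F y ∂μ) X := by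
  have hfin {A} (hA : 0 ≤ A) (X) (hX : X ∈ 𝒳) : sandwichTrace A X ≠ ∞ :=
    sandwichTrace_ne_top hA (h𝒳 X hX) (h𝒳tr X hX)
  let 𝒢 : Set C(Y, ℝ) :=
    {g | ∃ X ∈ 𝒳, ∀ y, g y = (sandwichTrace (F y) X).toReal - (sandwichTrace D X).toReal}
  have h𝒢conv : Convex ℝ 𝒢 := by
    rintro f ⟨X, hX, hf⟩ g ⟨X', hX', hg⟩ a b ha hb hab
    refine ⟨_, hconv hX hX' ha hb hab, fun y => ?_⟩
    rw [toReal_sandwichTrace_add_smul (hF0 y) (h𝒳 X hX) (h𝒳 X' hX') (h𝒳tr X hX) (h𝒳tr X' hX') ha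
        hb, toReal_sandwichTrace_add_smul hD (h𝒳 X hX) (h𝒳 X' hX') (h𝒳tr X hX) (h𝒳tr X' hX') ha hb]
    simp only [ContinuousMap.add_apply, ContinuousMap.smul_apply, smul_eq_mul, hf, hg]
    ring
  have h𝒢 : ∀ g ∈ 𝒢, ∃ y, 0 ≤ g y := by
    rintro g ⟨X, hX, hg⟩
    obtain ⟨y, hy⟩ := (le_ciSup_iff_exists_le
      (continuous_sandwichTrace hF hF0 (h𝒳 X hX) (h𝒳tr X hX))).1 (hle X hX)
    exact ⟨y, (hg y).symm ▸ sub_nonneg.2 (ENNReal.toReal_mono (hfin (hF0 y) X hX) hy)⟩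
  obtain ⟨μ, hμ, hint⟩ := exists_probabilityMeasure_integral_nonneg_of_convex h𝒢conv h𝒢
  refine ⟨μ, hμ, fun X hX => ?_⟩
  have hnonneg : 0 ≤ ∫ y, ((sandwichTrace (F y) X).toReal - (sandwichTrace D X).toReal) ∂μ :=
    hint ⟨fun y => (sandwichTrace (F y) X).toReal - (sandwichTrace D X).toReal,
      (continuous_toReal_sandwichTrace hF hF0 (h𝒳 X hX) (h𝒳tr X hX)).sub continuous_const⟩
      ⟨X, hX, fun _ => rfl⟩
  rw [integral_sub_toReal_sandwichTrace μ hF hF0 (h𝒳 X hX) (h𝒳tr X hX), sub_nonneg] at hnonneg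
  exact (ENNReal.toReal_le_toReal (hfin hD X hX) (hfin (integral_nonneg hF0) X hX)).1 hnonneg

theorem AttainsInfSpec.exists_probabilityMeasure_le_integral [T2Space Y] [Nonempty Y]
    (hinf : AttainsInfSpec 𝒮) (h𝒮 : 𝒮 ⊆ densityOperators K) (hconv : Convex ℝ 𝒮) (hδ : 0 < δ)
    (hF : Continuous F) (hF0 : ∀ y, 0 ≤ F y) (hD : 0 ≤ D)
    (hle : ∀ X ∈ rescaled D 𝒮 δ, sandwichTrace D X ≤ ⨆ y, sandwichTrace (F y) X) :
    ∃ μ : Measure Y, IsProbabilityMeasure μ ∧ D ≤ ∫ y, F y ∂μ := by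
  obtain ⟨R, hR, hRu, hmem⟩ := exists_conj_mem_rescaled hD 𝒮 hδ
  have himage : Convex ℝ ((fun ρ => R * ρ * R) '' 𝒮) :=
    hconv.is_linear_image ⟨fun ρ σ => by simp only [mul_add, add_mul], fun c ρ => by
      simp only [mul_smul_comm, smul_mul_assoc]⟩
  obtain ⟨μ, hμ, h⟩ := exists_probabilityMeasure_forall_sandwichTrace_le_integral hF hF0 hD himage
    (Set.forall_mem_image.2 fun ρ hρ => hR.conjugate_nonneg (h𝒮 hρ).1)
    (Set.forall_mem_image.2 fun ρ hρ => psdTrace_conj_ne_top (h𝒮 hρ).1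
      (psdTrace_ne_top_of_mem_densityOperators (h𝒮 hρ)) hR)
    (Set.forall_mem_image.2 fun ρ hρ => hle _ (hmem ρ hρ))
  exact ⟨μ, hμ, hinf.le_of_forall_sandwichTrace_conj_le h𝒮 hD (integral_nonneg hF0) hR hRu
    fun ρ hρ => h _ (Set.mem_image_of_mem _ hρ)⟩

theorem AttainsInfSpec.le_integral_of_forall_le_geomMean (hinf : AttainsInfSpec 𝒮)
    (h𝒮 : 𝒮 ⊆ densityOperators K) (hδ : 0 < δ) {ν : Measure Y} [IsProbabilityMeasure ν]
    (hF : Continuous F) (hF0 : ∀ y, 0 ≤ F y) (hD : 0 ≤ D)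
    (h : ∀ X ∈ rescaled D 𝒮 δ, sandwichTrace D X ≤ geomMean ν fun y => sandwichTrace (F y) X) :
    D ≤ ∫ y, F y ∂ν := by
  obtain ⟨R, hR, hRu, hmem⟩ := exists_conj_mem_rescaled hD 𝒮 hδ
  exact hinf.le_of_forall_sandwichTrace_conj_le h𝒮 hD (integral_nonneg hF0) hR hRu fun ρ hρ =>
    sandwichTrace_le_sandwichTrace_integral_of_le_geomMean hF hF0
      (hR.conjugate_nonneg (h𝒮 hρ).1)
      (psdTrace_conj_ne_top (h𝒮 hρ).1 (psdTrace_ne_top_of_mem_densityOperators (h𝒮 hρ)) hR)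
      (h _ (hmem ρ hρ))

end WeakBounds

section TensorPowers

variable {H : Type*} [NormedAddCommGroup H] [InnerProductSpace ℂ H] [CompleteSpace H]
  {Y : Type*} [TopologicalSpace Y] [CompactSpace Y] [Nonempty Y] {A : Y → H →L[ℂ] H}
  {C : H →L[ℂ] H} {𝒳 : (n : ℕ) → Set (HilbertPow H n →L[ℂ] HilbertPow H n)}

theorem exists_forall_sandwichTrace_le_geomMean [T2Space Y] [MeasurableSpace Y] [BorelSpace Y]
    (hA : ∀ y, 0 ≤ A y) (hC : 0 ≤ C) (h𝒳 : ∀ n, 1 ≤ n → ∀ X ∈ 𝒳 n, 0 ≤ X)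
    (hmul : ∀ n m, 1 ≤ n → 1 ≤ m → ∀ X₁ ∈ 𝒳 n, ∀ X₂ ∈ 𝒳 m, powTensor X₁ X₂ ∈ 𝒳 (n + m))
    (hcont : ∀ n, 1 ≤ n → ∀ X ∈ 𝒳 n, Continuous fun y => sandwichTrace (opPow (A y) n) X)
    (hfin : ∀ n, 1 ≤ n → ∀ X ∈ 𝒳 n, ∀ y, sandwichTrace (opPow (A y) n) X ≠ ∞)
    (hle : ∀ n, 1 ≤ n → ∀ X ∈ 𝒳 n,
      sandwichTrace (opPow C n) X ≤ ⨆ y, sandwichTrace (opPow (A y) n) X) :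
    ∃ ν : Measure Y, IsProbabilityMeasure ν ∧ ∀ n, 1 ≤ n → ∀ X ∈ 𝒳 n,
      sandwichTrace (opPow C n) X ≤ geomMean ν fun y => sandwichTrace (opPow (A y) n) X := by
  have hexists (n) (hn : 1 ≤ n) (X) (hX : X ∈ 𝒳 n) :=
    (le_ciSup_iff_exists_le (hcont n hn X hX)).1 (hle n hn X hX)
  let 𝒬 : Set (C(Y, ℝ) × ℝ) := {p | ∃ n, 1 ≤ n ∧ ∃ X ∈ 𝒳 n,
    (∀ y, p.1 y = (sandwichTrace (opPow (A y) n) X).toReal) ∧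
      p.2 = (sandwichTrace (opPow C n) X).toReal}
  have h𝒬nonneg : ∀ p ∈ 𝒬, ∀ y, 0 ≤ p.1 y := by
    rintro p ⟨n, -, X, -, hp1, -⟩ y
    exact hp1 y ▸ ENNReal.toReal_nonneg
  have h𝒬mul : ∀ p ∈ 𝒬, ∀ q ∈ 𝒬, p * q ∈ 𝒬 := by
    rintro p ⟨n, hn, X, hX, hp1, hp2⟩ q ⟨m, hm, X', hX', hq1, hq2⟩
    have htrace {B : H →L[ℂ] H} (hB : 0 ≤ B) :=
      sandwichTrace_powTensor hB (h𝒳 n hn X hX) (h𝒳 m hm X' hX')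
    refine ⟨n + m, by omega, powTensor X X', hmul n m hn hm X hX X' hX', fun y => ?_, ?_⟩
    · rw [htrace (hA y), ENNReal.toReal_mul, ← hp1, ← hq1, Prod.fst_mul, ContinuousMap.mul_apply]
    · rw [htrace hC, ENNReal.toReal_mul, ← hp2, ← hq2, Prod.snd_mul]
  have h𝒬le : ∀ p ∈ 𝒬, ∃ y, p.2 ≤ p.1 y := by
    rintro p ⟨n, hn, X, hX, hp1, hp2⟩
    obtain ⟨y, hy⟩ := hexists n hn X hX
    exact ⟨y, hp1 y ▸ hp2 ▸ ENNReal.toReal_mono (hfin n hn X hX y) hy⟩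
  obtain ⟨ν, hν, h⟩ := exists_forall_le_geomMean_of_mul_mem h𝒬nonneg h𝒬mul h𝒬le
  refine ⟨ν, hν, fun n hn X hX => ?_⟩
  obtain ⟨y, hy⟩ := hexists n hn X hX
  have hreal := h (⟨_, ENNReal.continuousOn_toReal.comp_continuous (hcont n hn X hX)
    (hfin n hn X hX)⟩, (sandwichTrace (opPow C n) X).toReal) ⟨n, hn, X, hX, fun _ => rfl, rfl⟩
  simpa only [ContinuousMap.coe_mk, Function.comp_apply, ENNReal.ofReal_toReal (hfin n hn X hX _),
    ENNReal.ofReal_toReal (ne_top_of_le_ne_top (hfin n hn X hX y) hy)] using hreal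

end TensorPowers

section TraceAssumption

variable {H : Type*} [NormedAddCommGroup H] [InnerProductSpace ℂ H]
  {Y : Type*} [TopologicalSpace Y] {A : Y → H →L[ℂ] H} {C : H →L[ℂ] H}
  {𝒳 : (n : ℕ) → Set (HilbertPow H n →L[ℂ] HilbertPow H n)} {n : ℕ}
  {X : HilbertPow H n →L[ℂ] HilbertPow H n}

theorem TraceAssumption.continuous_re_tr (h𝒳 : TraceAssumption A C 𝒳) (hn : 1 ≤ n)
    (hX : X ∈ 𝒳 n) : Continuous fun y => (tr (opPow (A y) n * X)).re :=
  Complex.continuous_re.comp (h𝒳.continuous_trace n hn X hX)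

variable [CompleteSpace H]

theorem TraceAssumption.sandwichTrace_family (h𝒳 : TraceAssumption A C 𝒳) (hA : ∀ y, 0 ≤ A y)
    (hn : 1 ≤ n) (hX : X ∈ 𝒳 n) (y : Y) :
    sandwichTrace (opPow (A y) n) X = ENNReal.ofReal (tr (opPow (A y) n * X)).re ∧
      0 ≤ (tr (opPow (A y) n * X)).re :=
  (h𝒳.traceClass_family n hn X hX y).sandwichTrace_eq (opPow_nonneg (hA y) n)
    (h𝒳.nonneg n hn X hX)

theorem TraceAssumption.sandwichTrace_bound (h𝒳 : TraceAssumption A C 𝒳) (hC : 0 ≤ C)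
    (hn : 1 ≤ n) (hX : X ∈ 𝒳 n) :
    sandwichTrace (opPow C n) X = ENNReal.ofReal (tr (opPow C n * X)).re :=
  ((h𝒳.traceClass_bound n hn X hX).sandwichTrace_eq (opPow_nonneg hC n) (h𝒳.nonneg n hn X hX)).1

theorem TraceAssumption.continuous_sandwichTrace (h𝒳 : TraceAssumption A C 𝒳)
    (hA : ∀ y, 0 ≤ A y) (hn : 1 ≤ n) (hX : X ∈ 𝒳 n) :
    Continuous fun y => sandwichTrace (opPow (A y) n) X := by
  simp only [(h𝒳.sandwichTrace_family hA hn hX _).1]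
  exact ENNReal.continuous_ofReal.comp (h𝒳.continuous_re_tr hn hX)

theorem TraceAssumption.re_tr_le_iSup_iff [CompactSpace Y] [Nonempty Y]
    (h𝒳 : TraceAssumption A C 𝒳) (hA : ∀ y, 0 ≤ A y) (hC : 0 ≤ C) (hn : 1 ≤ n) (hX : X ∈ 𝒳 n) :
    (tr (opPow C n * X)).re ≤ ⨆ y, (tr (opPow (A y) n * X)).re ↔
      sandwichTrace (opPow C n) X ≤ ⨆ y, sandwichTrace (opPow (A y) n) X := by
  rw [le_ciSup_iff_exists_le (h𝒳.continuous_re_tr hn hX),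
    le_ciSup_iff_exists_le (h𝒳.continuous_sandwichTrace hA hn hX)]
  refine exists_congr fun y => ?_
  rw [h𝒳.sandwichTrace_bound hC hn hX, (h𝒳.sandwichTrace_family hA hn hX y).1,
    ENNReal.ofReal_le_ofReal_iff (h𝒳.sandwichTrace_family hA hn hX y).2]

variable [MeasurableSpace Y]

theorem TraceAssumption.ofReal_re_tr_le_geomMean_iff (h𝒳 : TraceAssumption A C 𝒳)
    (hA : ∀ y, 0 ≤ A y) (hC : 0 ≤ C) (hn : 1 ≤ n) (hX : X ∈ 𝒳 n) (ν : Measure Y) :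
    ENNReal.ofReal (tr (opPow C n * X)).re ≤
        (geomMean ν fun y => ENNReal.ofReal (tr (opPow (A y) n * X)).re) ↔
      sandwichTrace (opPow C n) X ≤ geomMean ν fun y => sandwichTrace (opPow (A y) n) X := by
  simp only [h𝒳.sandwichTrace_bound hC hn hX, (h𝒳.sandwichTrace_family hA hn hX _).1]

theorem TraceAssumption.exists_forall_ofReal_re_tr_le_geomMean [CompactSpace Y] [T2Space Y]
    [Nonempty Y] [BorelSpace Y] (h𝒳 : TraceAssumption A C 𝒳) (hA : ∀ y, 0 ≤ A y) (hC : 0 ≤ C)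
    (hle : ∀ n, 1 ≤ n → ∀ X ∈ 𝒳 n,
      (tr (opPow C n * X)).re ≤ ⨆ y, (tr (opPow (A y) n * X)).re) :
    ∃ ν : Measure Y, IsProbabilityMeasure ν ∧ ∀ n, 1 ≤ n → ∀ X ∈ 𝒳 n,
      ENNReal.ofReal (tr (opPow C n * X)).re ≤
        geomMean ν fun y => ENNReal.ofReal (tr (opPow (A y) n * X)).re := by
  obtain ⟨ν, hν, h⟩ := exists_forall_sandwichTrace_le_geomMean hA hC h𝒳.nonneg h𝒳.tensor_mem
    (fun n hn X hX => h𝒳.continuous_sandwichTrace hA hn hX)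
    (fun n hn X hX y => (h𝒳.sandwichTrace_family hA hn hX y).1 ▸ ENNReal.ofReal_ne_top)
    fun n hn X hX => (h𝒳.re_tr_le_iSup_iff hA hC hn hX).1 (hle n hn X hX)
  exact ⟨ν, hν, fun n hn X hX =>
    (h𝒳.ofReal_re_tr_le_geomMean_iff hA hC hn hX ν).2 (h n hn X hX)⟩

end TraceAssumption

section Separation

variable {K : Type*} [NormedAddCommGroup K] [InnerProductSpace ℂ K]

theorem rankOne_self_nonneg (x : K) : 0 ≤ InnerProductSpace.rankOne ℂ x x :=
  (nonneg_iff_isPositive _).2 (InnerProductSpace.isPositive_rankOne_self x)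

variable [CompleteSpace K]

theorem sandwichTrace_rankOne_self {B : K →L[ℂ] K} (hB : 0 ≤ B) (x : K) :
    sandwichTrace B (InnerProductSpace.rankOne ℂ x x) = ENNReal.ofReal (⟪x, B x⟫_ℂ).re := by
  have hsqrt (y z : K) : ⟪CFC.sqrt B y, z⟫_ℂ = ⟪y, CFC.sqrt B z⟫_ℂ := by
    rw [← adjoint_inner_right, ← star_eq_adjoint, (isSelfAdjoint_sqrt B).star_eq]
  have hnorm : ENNReal.ofReal (⟪x, B x⟫_ℂ).re = ‖CFC.sqrt B x‖ₑ ^ 2 := by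
    have hBx : CFC.sqrt B (CFC.sqrt B x) = B x := by
      rw [← mul_apply_eq_comp, CFC.sqrt_mul_sqrt_self B]
    rw [← hBx, ← hsqrt, inner_self_eq_norm_sq_to_K, ← ofReal_norm,
      ← ENNReal.ofReal_pow (norm_nonneg _)]
    norm_cast
  rw [sandwichTrace_comm hB (rankOne_self_nonneg x), sandwichTrace_eq_tsum, hnorm,
    ← tsum_enorm_inner_sq (stdBasis K)]
  refine tsum_congr fun i => ?_
  rw [InnerProductSpace.rankOne_apply, inner_smul_right, hsqrt, ← hsqrt x,
    ← inner_conj_symm _ (CFC.sqrt B x), Complex.mul_conj', ← ofReal_norm, RCLike.norm_conj,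
    ← ENNReal.ofReal_pow (norm_nonneg _)]
  norm_cast

theorem le_of_forall_sandwichTrace_le {D M : K →L[ℂ] K} (hD : 0 ≤ D) (hM : 0 ≤ M)
    (h : ∀ X, 0 ≤ X → psdTrace X ≠ ∞ → sandwichTrace D X ≤ sandwichTrace M X) : D ≤ M := by
  rw [← sub_nonneg, nonneg_iff_isPositive, isPositive_def']
  refine ⟨(IsSelfAdjoint.of_nonneg hM).sub (.of_nonneg hD), fun x => ?_⟩
  have hx := rankOne_self_nonneg x
  have htr : psdTrace (InnerProductSpace.rankOne ℂ x x) ≠ ∞ := by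
    rw [← sandwichTrace_one_left hx, sandwichTrace_rankOne_self zero_le_one]
    exact ENNReal.ofReal_ne_top
  have hle := h _ hx htr
  rw [sandwichTrace_rankOne_self hD, sandwichTrace_rankOne_self hM,
    ENNReal.ofReal_le_ofReal_iff (re_inner_nonneg hM x)] at hle
  rw [reApplyInnerSelf_apply, ← inner_re_symm, sub_apply, inner_sub_right, map_sub]
  exact sub_nonneg.2 hle

theorem exists_norm_smul_eq_of_nonneg {X : K →L[ℂ] K} (hX : 0 ≤ X) :
    ∃ T : K →L[ℂ] K, 0 ≤ T ∧ T ≤ 1 ∧ ‖X‖ • T = X := by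
  rcases eq_or_ne X 0 with rfl | hX0
  · exact ⟨0, le_rfl, zero_le_one, by simp⟩
  have hnorm : 0 < ‖X‖ := norm_pos_iff.2 hX0
  refine ⟨‖X‖⁻¹ • X, smul_nonneg (by positivity) hX, ?_, smul_inv_smul₀ hnorm.ne' X⟩
  calc ‖X‖⁻¹ • X ≤ ‖X‖⁻¹ • ‖X‖ • (1 : K →L[ℂ] K) :=
        smul_le_smul_of_nonneg_left (le_norm_smul_one (.of_nonneg hX)) (by positivity)
    _ = 1 := inv_smul_smul₀ hnorm.ne' 1

theorem sandwichTrace_le_iSup_of_forall_le_one {ι : Type*} {F : ι → K →L[ℂ] K}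
    (hF0 : ∀ i, 0 ≤ F i) {D : K →L[ℂ] K} (hD : 0 ≤ D)
    (h : ∀ T, 0 ≤ T → T ≤ 1 → sandwichTrace D T ≤ ⨆ i, sandwichTrace (F i) T) {X : K →L[ℂ] K}
    (hX : 0 ≤ X) : sandwichTrace D X ≤ ⨆ i, sandwichTrace (F i) X := by
  obtain ⟨T, hT, hT1, hXT⟩ := exists_norm_smul_eq_of_nonneg hX
  have hscale {B : K →L[ℂ] K} (hB : 0 ≤ B) :
      sandwichTrace B X = ENNReal.ofReal ‖X‖ * sandwichTrace B T := by
    rw [← sandwichTrace_smul_right (norm_nonneg X) hB hT, hXT]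
  simp only [hscale hD, hscale (hF0 _), ← ENNReal.mul_iSup]
  gcongr
  exact h T hT hT1

theorem le_integral_of_forall_le_geomMean {Y : Type*} [TopologicalSpace Y] [CompactSpace Y]
    [MeasurableSpace Y] [BorelSpace Y] {ν : Measure Y} [IsProbabilityMeasure ν]
    {F : Y → K →L[ℂ] K} (hF : Continuous F) (hF0 : ∀ y, 0 ≤ F y) {D : K →L[ℂ] K} (hD : 0 ≤ D)
    (h : ∀ X, 0 ≤ X → sandwichTrace D X ≤ geomMean ν fun y => sandwichTrace (F y) X) :
    D ≤ ∫ y, F y ∂ν :=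
  le_of_forall_sandwichTrace_le hD (integral_nonneg hF0) fun X hX hXtr =>
    sandwichTrace_le_sandwichTrace_integral_of_le_geomMean hF hF0 hX hXtr (h X hX)

end Separation

section Regularization

theorem le_of_forall_le_ofReal_exp_mul {x s : ℝ≥0∞}
    (h : ∀ ε : ℝ, 0 < ε → x ≤ ENNReal.ofReal (Real.exp ε) * s) : x ≤ s := by
  have hlim : Tendsto (fun ε : ℝ => ENNReal.ofReal (Real.exp ε) * s) (𝓝[>] 0) (𝓝 s) := by
    have hexp := (ENNReal.continuous_ofReal.comp Real.continuous_exp).tendsto 0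
    simp only [Function.comp_def, Real.exp_zero, ENNReal.ofReal_one] at hexp
    simpa using (ENNReal.Tendsto.mul_const hexp (.inl one_ne_zero)).mono_left nhdsWithin_le_nhds
  exact ge_of_tendsto hlim (eventually_mem_nhdsWithin.mono h)

theorem eventually_le_exp_mul_of_limsup_log_le {κ : ℕ → ℝ} (hκ : ∀ N, 1 ≤ N → 0 < κ N)
    (hlim : limsup (fun N : ℕ => ((1 / (N : ℝ) * Real.log (κ N) : ℝ) : EReal)) atTop ≤ 0)
    {ε : ℝ} (hε : 0 < ε) : ∀ᶠ N : ℕ in atTop, κ N ≤ Real.exp (N * ε) := by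
  filter_upwards [eventually_lt_of_limsup_lt (hlim.trans_lt (EReal.coe_pos.2 hε)),
    eventually_ge_atTop 1] with N hN hN1
  rw [EReal.coe_lt_coe_iff, one_div, inv_mul_lt_iff₀ (by exact_mod_cast hN1)] at hN
  exact (Real.log_le_iff_le_exp (hκ N hN1)).1 hN.le

theorem le_of_forall_pow_le_of_limsup_log_le {κ : ℕ → ℝ} (hκ : ∀ N, 1 ≤ N → 0 < κ N)
    (hlim : limsup (fun N : ℕ => ((1 / (N : ℝ) * Real.log (κ N) : ℝ) : EReal)) atTop ≤ 0)
    {n : ℕ} (hn : 1 ≤ n) {x s : ℝ≥0∞}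
    (h : ∀ k, 1 ≤ k → x ^ k ≤ ENNReal.ofReal (κ (k * n)) * s ^ k) : x ≤ s := by
  refine le_of_forall_le_ofReal_exp_mul fun ε hε => ?_
  have hn0 : (0 : ℝ) < n := by exact_mod_cast hn
  have hmul : Tendsto (fun k : ℕ => k * n) atTop atTop :=
    tendsto_id.atTop_mul_const' (by omega)
  obtain ⟨k, hk, hk1⟩ := ((hmul.eventually (eventually_le_exp_mul_of_limsup_log_le hκ hlim
    (div_pos hε hn0))).and (eventually_ge_atTop 1)).exists
  have hexp : Real.exp ((k * n : ℕ) * (ε / n)) = Real.exp ε ^ k := by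
    rw [← Real.exp_nat_mul]
    congr 1
    push_cast
    field_simp
  refine (ENNReal.pow_le_pow_left_iff (by omega : k ≠ 0)).1 ?_
  calc x ^ k ≤ ENNReal.ofReal (κ (k * n)) * s ^ k := h k hk1
    _ ≤ ENNReal.ofReal (Real.exp ε ^ k) * s ^ k := by
        gcongr
        exact hk.trans_eq hexp
    _ = (ENNReal.ofReal (Real.exp ε) * s) ^ k := by
        rw [ENNReal.ofReal_pow (Real.exp_pos ε).le, mul_pow]

end Regularization

section DominatedOperators

variable {H : Type*} [NormedAddCommGroup H] [InnerProductSpace ℂ H] [CompleteSpace H]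
  {ℛ : Set (H →L[ℂ] H)} {C : H →L[ℂ] H} {n : ℕ}

theorem exists_test_forall_sandwichTrace_eq_pow {T : HilbertPow H n →L[ℂ] HilbertPow H n}
    (hT : 0 ≤ T) (hT1 : T ≤ 1) {k : ℕ} (hk : 1 ≤ k) :
    ∃ S : HilbertPow H (k * n) →L[ℂ] HilbertPow H (k * n), 0 ≤ S ∧ S ≤ 1 ∧
      ∀ B : H →L[ℂ] H, 0 ≤ B →
        sandwichTrace (opPow B (k * n)) S = sandwichTrace (opPow B n) T ^ k := by
  induction k, hk using Nat.le_induction with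
  | base =>
    rw [one_mul]
    exact ⟨T, hT, hT1, fun B _ => (pow_one _).symm⟩
  | succ k _ ih =>
    obtain ⟨S, hS, hS1, h⟩ := ih
    rw [Nat.succ_mul]
    refine ⟨powTensor S T, powTensor_nonneg hS hT, powTensor_le_one hS hS1 hT hT1, fun B hB => ?_⟩
    rw [sandwichTrace_powTensor hB hS hT, h B hB, pow_succ]

theorem sandwichTrace_le_iSup_of_mem_dominatedOperators (hℛ : ℛ ⊆ densityOperators H)
    (hC : C ∈ dominatedOperators ℛ) (hn : 1 ≤ n) {T : HilbertPow H n →L[ℂ] HilbertPow H n}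
    (hT : 0 ≤ T) (hT1 : T ≤ 1) :
    sandwichTrace (opPow C n) T ≤ ⨆ ω ∈ ℛ, sandwichTrace (opPow ω n) T := by
  obtain ⟨hC0, κ, hκ, hle, hlim⟩ := hC
  refine le_of_forall_pow_le_of_limsup_log_le hκ hlim hn fun k hk => ?_
  obtain ⟨S, hS, hS1, hpow⟩ := exists_test_forall_sandwichTrace_eq_pow hT hT1 hk
  rw [← hpow C hC0]
  refine (hle (k * n) (Nat.mul_pos hk hn) S hS hS1).trans ?_
  gcongr
  refine iSup₂_le fun ω hω => ?_
  rw [hpow ω (hℛ hω).1]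
  gcongr
  exact le_iSup₂ (f := fun ω _ => sandwichTrace (opPow ω n) T) ω hω

theorem mem_dominatedOperators_of_sandwichTrace_le_iSup (hC : 0 ≤ C)
    (h : ∀ n, 1 ≤ n → ∀ T : HilbertPow H n →L[ℂ] HilbertPow H n, 0 ≤ T → T ≤ 1 →
      sandwichTrace (opPow C n) T ≤ ⨆ ω ∈ ℛ, sandwichTrace (opPow ω n) T) :
    C ∈ dominatedOperators ℛ :=
  ⟨hC, fun _ => 1, fun _ _ => one_pos, fun n hn T hT hT1 => by simpa using h n hn T hT hT1,
    by simp⟩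

theorem exists_forall_sandwichTrace_le_geomMean_of_tests (hℛ : ℛ ⊆ densityOperators H)
    (hℛc : IsCompact ℛ) (hℛne : ℛ.Nonempty) (hC : 0 ≤ C)
    (h : ∀ n, 1 ≤ n → ∀ T : HilbertPow H n →L[ℂ] HilbertPow H n, 0 ≤ T → T ≤ 1 →
      sandwichTrace (opPow C n) T ≤ ⨆ ω ∈ ℛ, sandwichTrace (opPow ω n) T) :
    ∃ ν : Measure ℛ, IsProbabilityMeasure ν ∧
      ∀ n, 1 ≤ n → ∀ X : HilbertPow H n →L[ℂ] HilbertPow H n, 0 ≤ X →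
        sandwichTrace (opPow C n) X ≤
          geomMean ν fun ω => sandwichTrace (opPow (ω : H →L[ℂ] H) n) X := by
  have : CompactSpace ℛ := isCompact_iff_compactSpace.1 hℛc
  have : Nonempty ℛ := hℛne.to_subtype
  have hpow (n) (hn : 1 ≤ n) (ω : ℛ) := opPow_mem_densityOperators (hℛ ω.2) hn
  refine exists_forall_sandwichTrace_le_geomMean (𝒳 := fun n => {X | 0 ≤ X})
    (fun ω => (hℛ ω.2).1) hC (fun _ _ _ hX => hX)
    (fun _ _ _ _ _ hX _ hX' => powTensor_nonneg hX hX')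
    (fun n hn X hX => continuous_sandwichTrace_of_mem_densityOperators
      (continuous_opPow continuous_subtype_val n) (hpow n hn) hX)
    (fun n hn X hX ω => ?_) (fun n hn X hX => ?_)
  · rw [sandwichTrace_comm (hpow n hn ω).1 hX]
    exact sandwichTrace_ne_top hX (hpow n hn ω).1
      (psdTrace_ne_top_of_mem_densityOperators (hpow n hn ω))
  · refine sandwichTrace_le_iSup_of_forall_le_one (fun ω => (hpow n hn ω).1) (opPow_nonneg hC n)
      (fun T hT hT1 => ?_) hX
    rw [← iSup_subtype' (p := (· ∈ ℛ)) (f := fun ω _ => sandwichTrace (opPow ω n) T)]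
    exact h n hn T hT hT1

end DominatedOperators

end WeakMean

theorem mainTheorem8 {H : Type u} [NormedAddCommGroup H] [InnerProductSpace ℂ H]
    [CompleteSpace H] :
    (∀ {Y : Type v} [TopologicalSpace Y] [CompactSpace Y] [T2Space Y] [Nonempty Y]
        [MeasurableSpace Y] [BorelSpace Y]
        (A : Y → (H →L[ℂ] H)) (_ : ∀ y, 0 ≤ A y) (_ : Continuous A)
        (C : H →L[ℂ] H) (_ : 0 ≤ C)
        (𝒳 : (n : ℕ) → Set (HilbertPow H n →L[ℂ] HilbertPow H n)) (_ : TraceAssumption A C 𝒳)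
        (_ : ∀ n, 1 ≤ n → CharacterizesOrder (𝒳 n))
        (𝒮 : (n : ℕ) → Set (HilbertPow H n →L[ℂ] HilbertPow H n)) (δ : ℕ → ℝ)
        (_ : ∀ n, 1 ≤ n → 0 < δ n ∧ 𝒮 n ⊆ densityOperators (HilbertPow H n) ∧ Convex ℝ (𝒮 n) ∧
          AttainsInfSpec (𝒮 n) ∧ rescaled (opPow C n) (𝒮 n) (δ n) ⊆ 𝒳 n),
      List.TFAE [
        ∀ n, 1 ≤ n → ∀ X : HilbertPow H n →L[ℂ] HilbertPow H n, 0 ≤ X →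
          sandwichTrace (opPow C n) X ≤ ⨆ y, sandwichTrace (opPow (A y) n) X,
        ∀ n, 1 ≤ n → ∀ X ∈ 𝒳 n,
          (tr (opPow C n * X)).re ≤ ⨆ y, (tr (opPow (A y) n * X)).re,
        ∀ n, 1 ≤ n → ∀ X ∈ rescaled (opPow C n) (𝒮 n) (δ n),
          (tr (opPow C n * X)).re ≤ ⨆ y, (tr (opPow (A y) n * X)).re,
        ∀ n, 1 ≤ n → ∃ μ : Measure Y, IsProbabilityMeasure μ ∧
          opPow C n ≤ ∫ y, opPow (A y) n ∂μ,
        ∃ μ : Measure Y, IsProbabilityMeasure μ ∧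
          ∀ n, 1 ≤ n → opPow C n ≤ ∫ y, opPow (A y) n ∂μ,
        ∃ ν : Measure Y, IsProbabilityMeasure ν ∧ ∀ n, 1 ≤ n → ∀ X ∈ 𝒳 n,
          ENNReal.ofReal (tr (opPow C n * X)).re ≤
            geomMean ν fun y => ENNReal.ofReal (tr (opPow (A y) n * X)).re]) ∧
    (∀ (R : Set (H →L[ℂ] H)) (_ : R ⊆ densityOperators H) (_ : IsCompact R) (_ : R.Nonempty)
        (C : H →L[ℂ] H) (_ : 0 ≤ C),
      List.TFAE [
        C ∈ dominatedOperators R,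
        ∀ n, 1 ≤ n → ∀ T : HilbertPow H n →L[ℂ] HilbertPow H n, 0 ≤ T → T ≤ 1 →
          sandwichTrace (opPow C n) T ≤ ⨆ ω ∈ R, sandwichTrace (opPow ω n) T,
        ∃ μ : Measure R, IsProbabilityMeasure μ ∧
          ∀ n, 1 ≤ n → opPow C n ≤ ∫ ω, opPow (ω : H →L[ℂ] H) n ∂μ,
        ∃ ν : Measure R, IsProbabilityMeasure ν ∧
          ∀ n, 1 ≤ n → ∀ X : HilbertPow H n →L[ℂ] HilbertPow H n, 0 ≤ X →
            sandwichTrace (opPow C n) X ≤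
              geomMean ν fun ω => sandwichTrace (opPow (ω : H →L[ℂ] H) n) X]) := by
  refine ⟨?_, fun R hR hRc hRne C hC => ?_⟩
  · intro Y _ _ _ _ _ _ A hA hAc C hC 𝒳 h𝒳 _ 𝒮 δ h𝒮
    have hF n := continuous_opPow hAc n
    have hF0 n y := opPow_nonneg (hA y) n
    tfae_have 1 → 2 := fun h n hn X hX =>
      (h𝒳.re_tr_le_iSup_iff hA hC hn hX).2 (h n hn X (h𝒳.nonneg n hn X hX))
    tfae_have 2 → 3 := fun h n hn X hX => h n hn X ((h𝒮 n hn).2.2.2.2 hX)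
    tfae_have 3 → 4 := fun h n hn =>
      let ⟨hδ, h𝒮d, hconv, hinf, hsub⟩ := h𝒮 n hn
      hinf.exists_probabilityMeasure_le_integral h𝒮d hconv hδ (hF n) (hF0 n) (opPow_nonneg hC n)
        fun X hX => (h𝒳.re_tr_le_iSup_iff hA hC hn (hsub hX)).1 (h n hn X hX)
    tfae_have 4 → 1 := fun h n hn X _ =>
      let ⟨μ, _, hμ⟩ := h n hn
      sandwichTrace_le_iSup_of_le_integral (integrable_of_continuous μ (hF n)) (hF0 n) hμ X
    tfae_have 2 → 6 := h𝒳.exists_forall_ofReal_re_tr_le_geomMean hA hC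
    tfae_have 6 → 5 := fun ⟨ν, hν, h⟩ => ⟨ν, hν, fun n hn =>
      let ⟨hδ, h𝒮d, _, hinf, hsub⟩ := h𝒮 n hn
      hinf.le_integral_of_forall_le_geomMean h𝒮d hδ (hF n) (hF0 n) (opPow_nonneg hC n) fun X hX =>
        (h𝒳.ofReal_re_tr_le_geomMean_iff hA hC hn (hsub hX) ν).1 (h n hn X (hsub hX))⟩
    tfae_have 5 → 4 := fun ⟨μ, hμ, h⟩ n hn => ⟨μ, hμ, h n hn⟩
    tfae_finish
  · have : CompactSpace R := isCompact_iff_compactSpace.1 hRc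
    have hF n := continuous_opPow (continuous_subtype_val (p := (· ∈ R))) n
    have hF0 n (ω : R) := opPow_nonneg (hR ω.2).1 n
    tfae_have 1 → 2 := fun h n hn T =>
      sandwichTrace_le_iSup_of_mem_dominatedOperators hR h hn
    tfae_have 2 → 1 := mem_dominatedOperators_of_sandwichTrace_le_iSup hC
    tfae_have 2 → 4 := exists_forall_sandwichTrace_le_geomMean_of_tests hR hRc hRne hC
    tfae_have 4 → 3 := fun ⟨ν, hν, h⟩ => ⟨ν, hν, fun n hn =>
      le_integral_of_forall_le_geomMean (hF n) (hF0 n) (opPow_nonneg hC n) (h n hn)⟩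
    tfae_have 3 → 2 := fun ⟨μ, _, h⟩ n hn T _ _ => by
      rw [iSup_subtype']
      exact sandwichTrace_le_iSup_of_le_integral (integrable_of_continuous μ (hF n)) (hF0 n)
        (h n hn) T
    tfae_finish
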